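/- **Setting.** A *graph* is a nonempty finite set with a reflexive symmetric edge relation $\sqcap$; two different vertices joined by an edge are adjacent, the degree of a vertex is the number of vertices adjacent to it, and an *end* is a vertex of degree at most $1$. A set of vertices is connected if it has no partition into two nonempty sets with no edge between them. A relation $R\subseteq H\times G$ between graphs is viewed as a morphism from $G$ to $H$ and is *edge-preserving* if $h\,R\,g\sqcap g'$ and $h'\,R\,g'$ imply $h\sqcap h'$; it is *co-bijective* if every $g\in G$ is related to some $h\in H$ and for every $h\in H$ there is $g\in G$ for which $h$ is the only element related to $g$. It is *monotone* if the set of elements of $G$ related to some element of $C$ is connected whenever $C\subseteq H$ is connected. A *graph fan* is a tree with exactly one vertex of degree at least $3$, its *root*; its *spokes* are the vertex sets of the paths from the root to an end. The category $\mathbf L$ has graph fans as objects and, as morphisms, the co-bijective edge-preserving relations $R\subseteq H\times G$ such that the root of $H$ is the only element related to the root of $G$, and every spoke $S$ of $G$ has image contained in some spoke $T$ of $H$ for which $R\cap(T\times S)$ is monotone (as a relation between the induced subgraphs). The category $\mathbf X$ has the same objects, and its morphisms are the morphisms of $\mathbf L$ for which every element related to an end of $G$ is an end of $H$. A *sequence*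 in such a category consists of objects $G_n$ and morphisms $\sqsupset^m_n\subseteq G_m\times G_n$ ($m\le n$) with $\sqsupset^n_n$ the identity and ${\sqsupset^l_m}\circ{\sqsupset^m_n}={\sqsupset^l_n}$ for $l\le m\le n$. Its *induced poset* is $\bigsqcup_n G_n$, with $p\le q$ for $p\in G_n$, $q\in G_m$ iff $m\le n$ and $q\sqsupset^m_n p$. In a poset $\mathbb P$, a *band* is a finite set such that every element of $\mathbb P$ is comparable to one of its members, a *cap* is a set $C$ for which there is a band each of whose members lies below some member of $C$, and a *selector* is a set meeting every cap. The *spectrum* of $\mathbb P$ is the set of minimal selectors with the topology generated by the sets $\{S: p\in S\}$, $p\in\mathbb P$. The spectrum of a sequence is the spectrum of its induced poset. A space *is the spectrum* of a sequence if it is homeomorphic to it. A *continuum* is a nonempty compact connected metrizable space. A *dendroid* is a continuum in which any two distinct points are the endpoints of an arc and the intersection of any two subcontinua is connected (possibly empty). A *fan* is a dendroid with exactly one ramification point, i.e. exactly one point $x$ for which there are three arcs any two of which meet exactly in $x$. The *Cantor fan* is the quotient $X=([0,1]\times 2^\omega)/(\{0\}\times 2^\omega)$. A *smooth fan* is a space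 homeomorphic to a subspace of the Cantor fan that is a fan. For $a,b\in\omega$ let $\mathcal G_{a,b}$ be the family of the images in $X$ of the sets $$\bigl(A_{a,0}\cap[0,1]\bigr)\times 2^\omega\quad\text{and}\quad \bigl(A_{a,k}\cap[0,1]\bigr)\times B_s\qquad(0<k\le 2^a,\ s\in 2^b),$$ where $A_{a,k}=\bigl(\tfrac{k-1}{2^a},\tfrac{k+1}{2^a}\bigr)$ and $B_s\subseteq 2^\omega$ is the set of sequences extending $s$. For $Y\subseteq X$ let $\mathcal G_{a,b}|Y$ be the family of those sets $g\cap Y$, $g\in\mathcal G_{a,b}$, for which the centre $k/2^a$ of $g$ belongs to the projection of $g\cap Y$ to $[0,1]$. A sequence of families of sets $(\mathcal C_n)$ is regarded as a system of graphs and relations by putting $g\sqcap g'$ iff $g\cap g'\neq\emptyset$ for $g,g'\in\mathcal C_n$, and $g\sqsupset^m_n h$ iff $g\supseteq h$ for $m\le n$, $g\in\mathcal C_m$, $h\in\mathcal C_n$. **Corollary.** 1. The Cantor fan is the spectrum of a sequence in $\mathbf X$. 2. Every smooth fan is the spectrum of a sequence in $\mathbf L$. 3. The sequence in 1 can be obtained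 from product covers: for all strictly increasing $\alpha,\beta\colon\omega\to\omega$ there is $n_0$ such that $(\mathcal G_{\alpha(n),\beta(n)})_{n\ge n_0}$ is a sequence in $\mathbf X$ whose spectrum is the Cantor fan. 4. The sequences in 2 can be obtained by restricting product covers: for every subspace $Y$ of the Cantor fan that is a fan there are a strictly increasing $\alpha\colon\omega\to\omega$ and $n_0$ such that $(\mathcal G_{\alpha(n),n}|Y)_{n\ge n_0}$ is a sequence in $\mathbf L$ whose spectrum is $Y$. -/

import Mathlib

open Set Topology

namespace FanSpec

universe u

/-! ### The spectrum of a poset -/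

section Spectrum

variable {P : Type u} [PartialOrder P]

/-- A band: a finite set such that every element of the poset is comparable to one of its members. -/
def IsBand (B : Set P) : Prop :=
  B.Finite ∧ ∀ p : P, ∃ b ∈ B, b ≤ p ∨ p ≤ b

/-- A cap: a set refined by a band. -/
def IsCap (C : Set P) : Prop :=
  ∃ B : Set P, IsBand B ∧ ∀ b ∈ B, ∃ c ∈ C, b ≤ c

/-- A selector: a set meeting every cap. -/
def IsSelector (S : Set P) : Prop :=
  ∀ C : Set P, IsCap C → (S ∩ C).Nonempty

end Spectrum

/-- The spectrum of a poset: its minimal selectors (with respect to inclusion). -/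
def Spectrum (P : Type u) [PartialOrder P] : Type u :=
  {S : Set P // Minimal IsSelector S}

/-- The topology of the spectrum is generated by the sets `{S | p ∈ S}`. -/
instance (P : Type u) [PartialOrder P] : TopologicalSpace (Spectrum P) :=
  TopologicalSpace.generateFrom {U | ∃ p : P, U = {S : Spectrum P | p ∈ S.1}}

/-! ### Graphs and relations between graphs

A reflexive symmetric edge relation on `V` is recorded by its irreflexive part, a `SimpleGraph`.
A relation `R : V → W → Prop` is viewed as going from the graph on `W` to the graph on `V`. -/

section Graphs

variable {V W : Type}

/-- The reflexive edge relation of a graph. -/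
def Edge (G : SimpleGraph V) (a b : V) : Prop :=
  a = b ∨ G.Adj a b

/-- Edge-preserving relations. -/
def EdgePreserving (H : SimpleGraph V) (G : SimpleGraph W) (R : V → W → Prop) : Prop :=
  ∀ h h' g g', R h g → Edge G g g' → R h' g' → Edge H h h'

/-- Every `h` is the only element related to some `g`. -/
def CoInjective (R : V → W → Prop) : Prop :=
  ∀ h, ∃ g, ∀ h', R h' g ↔ h' = h

/-- Every `g` is related to some `h`. -/
def CoSurjective (R : V → W → Prop) : Prop :=
  ∀ g, ∃ h, R h g

/-- The degree of a vertex (all graphs considered are finite). -/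
noncomputable def deg (G : SimpleGraph V) (v : V) : ℕ :=
  (G.neighborSet v).ncard

/-- Ends of a graph: vertices of degree at most one. -/
def IsEnd (G : SimpleGraph V) (v : V) : Prop :=
  deg G v ≤ 1

/-- Vertices of degree at least three; a fan has exactly one, its root. -/
def IsRoot (G : SimpleGraph V) (v : V) : Prop :=
  3 ≤ deg G v

/-- A (graph) fan: a tree with exactly one vertex of degree at least three. -/
def IsGraphFan (G : SimpleGraph V) : Prop :=
  G.IsTree ∧ ∃! v, IsRoot G v

/-- Spokes of a fan: vertex sets of paths from the root to an end. -/
def IsSpoke (G : SimpleGraph V) (S : Set V) : Prop :=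
  ∃ r e : V, IsRoot G r ∧ IsEnd G e ∧ ∃ p : G.Walk r e, p.IsPath ∧ S = {v | v ∈ p.support}

/-- A set of vertices is connected if it has no partition into two nonempty sets without an edge
between them; the empty set is connected in this sense. -/
def ConnectedSet (G : SimpleGraph V) (A : Set V) : Prop :=
  (G.induce A).Preconnected

/-- The restriction of `R` to `T × S` is a monotone relation between the induced subgraphs:
preimages of connected sets are connected. -/
def MonotoneOn (H : SimpleGraph V) (G : SimpleGraph W) (R : V → W → Prop)
    (T : Set V) (S : Set W) : Prop :=
  ∀ C ⊆ T, ConnectedSet H C → ConnectedSet G {g ∈ S | ∃ h ∈ C, R h g}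

/-- Spoke-monotone relations between fans: the image of the root is the singleton of the root, and
each spoke `S` is mapped monotonically into some spoke `T`. -/
def SpokeMonotone (H : SimpleGraph V) (G : SimpleGraph W) (R : V → W → Prop) : Prop :=
  (∀ r, IsRoot G r → ∀ h, R h r ↔ IsRoot H h) ∧
  ∀ S, IsSpoke G S → ∃ T, IsSpoke H T ∧
    (∀ g ∈ S, ∀ h, R h g → h ∈ T) ∧ MonotoneOn H G R T S

/-- The image of an end consists of ends. -/
def EndPreserving (H : SimpleGraph V) (G : SimpleGraph W) (R : V → W → Prop) : Prop :=
  ∀ e, IsEnd G e → ∀ h, R h e → IsEnd H h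

/-- Morphisms (from `G` to `H`) of the category `𝐋`: co-bijective edge-preserving
spoke-monotone relations. -/
def IsMorL (H : SimpleGraph V) (G : SimpleGraph W) (R : V → W → Prop) : Prop :=
  EdgePreserving H G R ∧ CoInjective R ∧ CoSurjective R ∧ SpokeMonotone H G R

/-- Morphisms of the category `𝐗`: end-preserving morphisms of `𝐋`. -/
def IsMorX (H : SimpleGraph V) (G : SimpleGraph W) (R : V → W → Prop) : Prop :=
  IsMorL H G R ∧ EndPreserving H G R

end Graphs

/-! ### Sequences of graphs -/

/-- A sequence of nonempty finite graphs and edge-preserving relations, i.e. a functor from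
the order `ω` to the category of graphs: `rel h a b` (for `h : m ≤ n`) is the relation
from the `n`-th graph to the `m`-th one. -/
structure GraphSeq where
  V : ℕ → Type
  finite : ∀ n, Finite (V n)
  nonempty : ∀ n, Nonempty (V n)
  graph : ∀ n, SimpleGraph (V n)
  rel : ∀ {m n : ℕ}, m ≤ n → V m → V n → Prop
  edgePreserving : ∀ {m n : ℕ} (h : m ≤ n), EdgePreserving (graph m) (graph n) (rel h)
  rel_self : ∀ n (a b : V n), rel (le_refl n) a b ↔ a = b
  rel_comp : ∀ {l m n : ℕ} (h : l ≤ m) (h' : m ≤ n) (a : V l) (c : V n),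
    rel (h.trans h') a c ↔ ∃ b : V m, rel h a b ∧ rel h' b c

namespace GraphSeq

variable (S : GraphSeq)

/-- The sequence is a sequence in the category `𝐋`. -/
def InL : Prop :=
  (∀ n, IsGraphFan (S.graph n)) ∧
    ∀ {m n : ℕ} (h : m ≤ n), IsMorL (S.graph m) (S.graph n) (S.rel h)

/-- The sequence is a sequence in the category `𝐗`. -/
def InX : Prop :=
  (∀ n, IsGraphFan (S.graph n)) ∧
    ∀ {m n : ℕ} (h : m ≤ n), IsMorX (S.graph m) (S.graph n) (S.rel h)

/-- The underlying set of the induced poset: the disjoint union of all vertex sets. -/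
def Poset : Type := Σ n, S.V n

/-- `(n, p) ≤ (m, q)` iff `m ≤ n` and `q` is related to `p`. -/
instance : PartialOrder S.Poset where
  le x y := ∃ h : y.1 ≤ x.1, S.rel h y.2 x.2
  le_refl x := ⟨le_refl _, (S.rel_self _ _ _).2 rfl⟩
  le_trans := by
    rintro x y z ⟨h, r⟩ ⟨h', r'⟩
    exact ⟨h'.trans h, (S.rel_comp h' h _ _).2 ⟨_, r', r⟩⟩
  le_antisymm := by
    rintro ⟨n, a⟩ ⟨m, b⟩ ⟨h, r⟩ ⟨h', r'⟩
    obtain rfl : m = n := le_antisymm h h'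
    obtain rfl : a = b := (S.rel_self _ _ _).1 r'
    rfl

/-- The spectrum of the sequence is the spectrum of its induced poset. -/
abbrev Spec : Type := Spectrum S.Poset

/-- The sequence is isomorphic to the one given by the families of sets `𝒞 n`, with overlap as the
edge relation and inclusion as the relations between the graphs. -/
def IsRealizedBy {X : Type} (𝒞 : ℕ → Set (Set X)) : Prop :=
  ∃ U : ∀ n, S.V n → Set X,
    (∀ n, Function.Injective (U n) ∧ range (U n) = 𝒞 n) ∧
    (∀ n (g g' : S.V n), Edge (S.graph n) g g' ↔ (U n g ∩ U n g').Nonempty) ∧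
    ∀ {m n : ℕ} (h : m ≤ n) (g : S.V m) (g' : S.V n), S.rel h g g' ↔ U n g' ⊆ U m g

end GraphSeq

/-! ### Topological fans -/

section TopFan

variable (X : Type u) [TopologicalSpace X]

/-- A continuum: a nonempty compact connected metrizable space. -/
def IsContinuum : Prop :=
  CompactSpace X ∧ ConnectedSpace X ∧ TopologicalSpace.MetrizableSpace X

/-- Any two distinct points are the endpoints of an arc. -/
def ArcwiseConnected : Prop :=
  ∀ x y : X, x ≠ y → ∃ f : unitInterval → X, IsEmbedding f ∧ f 0 = x ∧ f 1 = y

/-- The intersection of any two subcontinua is connected (possibly empty). -/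
def HereditarilyUnicoherent : Prop :=
  ∀ C D : Set X, IsClosed C → IsConnected C → IsClosed D → IsConnected D → IsPreconnected (C ∩ D)

/-- Dendroids. -/
def IsDendroid : Prop :=
  IsContinuum X ∧ ArcwiseConnected X ∧ HereditarilyUnicoherent X

variable {X}

/-- An arc: a subset homeomorphic to the unit interval. -/
def IsArc (A : Set X) : Prop :=
  Nonempty (A ≃ₜ unitInterval)

/-- Ramification points: there are three arcs pairwise meeting exactly at the point. -/
def IsRamificationPoint (x : X) : Prop :=
  ∃ A : Fin 3 → Set X, (∀ i, IsArc (A i)) ∧ ∀ i j, i ≠ j → A i ∩ A j = {x}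

variable (X)

/-- A (topological) fan: a dendroid with exactly one ramification point. -/
def IsTopFan : Prop :=
  IsDendroid X ∧ ∃! x : X, IsRamificationPoint x

end TopFan

/-! ### The Cantor fan and smooth fans -/

/-- The equivalence relation on `[0,1] × 2^ω` collapsing `{0} × 2^ω` to a point. -/
def cantorFanSetoid : Setoid (unitInterval × (ℕ → Bool)) where
  r p q := p = q ∨ (p.1 = 0 ∧ q.1 = 0)
  iseqv :=
    { refl := fun _ => Or.inl rfl
      symm := by
        rintro p q (h | ⟨h, h'⟩)
        · exact Or.inl h.symm
        · exact Or.inr ⟨h', h⟩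
      trans := by
        rintro p q r (rfl | ⟨h, h'⟩) (rfl | ⟨k, k'⟩)
        · exact Or.inl rfl
        · exact Or.inr ⟨k, k'⟩
        · exact Or.inr ⟨h, h'⟩
        · exact Or.inr ⟨h, k'⟩ }

/-- The Cantor fan, with the quotient topology. -/
def CantorFan : Type := Quotient cantorFanSetoid

instance : TopologicalSpace CantorFan :=
  inferInstanceAs (TopologicalSpace (Quotient cantorFanSetoid))

/-- The quotient map onto the Cantor fan. -/
def CantorFan.mk (p : unitInterval × (ℕ → Bool)) : CantorFan :=
  Quotient.mk cantorFanSetoid p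

/-- The projection of the Cantor fan to the unit interval. -/
def CantorFan.height : CantorFan → unitInterval :=
  Quotient.lift Prod.fst (by
    rintro p q (rfl | ⟨h, h'⟩)
    · rfl
    · exact h.trans h'.symm)

/-- A smooth fan: a space homeomorphic to a subfan of the Cantor fan. -/
def IsSmoothFan (Z : Type u) [TopologicalSpace Z] : Prop :=
  ∃ Y : Set CantorFan, IsTopFan Y ∧ Nonempty (Z ≃ₜ Y)

/-! ### The product covers -/

/-- The image in the Cantor fan of `((k-1)/2^a, (k+1)/2^a) × B_s`, where `B_s ⊆ 2^ω` is the set of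
sequences extending `s`. -/
def fanCell (a k : ℕ) {b : ℕ} (s : Fin b → Bool) : Set CantorFan :=
  CantorFan.mk '' {p | ((k : ℝ) - 1) / 2 ^ a < p.1 ∧ (p.1 : ℝ) < ((k : ℝ) + 1) / 2 ^ a ∧
    ∀ i : Fin b, p.2 i = s i}

/-- `g` is the member with centre `k / 2^a` of the cover of the Cantor fan with parameters `a, b`:
for `k = 0` it is the neighbourhood of the root, with no condition on the second coordinate, and for
`0 < k ≤ 2^a` it is one of the `2^b` product sets. -/
def IsFanCell (a b k : ℕ) (g : Set CantorFan) : Prop :=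
  (k = 0 ∧ g = fanCell a 0 (Fin.elim0 : Fin 0 → Bool)) ∨
    (0 < k ∧ k ≤ 2 ^ a ∧ ∃ s : Fin b → Bool, g = fanCell a k s)

/-- The product cover of the Cantor fan with parameters `a, b`. -/
def fanCover (a b : ℕ) : Set (Set CantorFan) :=
  {g | ∃ k, IsFanCell a b k g}

/-- The cover of `Y` obtained from the product cover: the sets `g ∩ Y` such that the centre of `g`
belongs to the projection of `g ∩ Y` to the unit interval. -/
def restrictedCover (a b : ℕ) (Y : Set CantorFan) : Set (Set CantorFan) :=
  {h | ∃ k g, IsFanCell a b k g ∧ (∃ x ∈ g ∩ Y, (x.height : ℝ) = (k : ℝ) / 2 ^ a) ∧ h = g ∩ Y}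

end FanSpec

/-! The link between posets and spaces is `spectrum_homeomorph`: if the elements of a poset label a
basis of open sets of a T₁ space and the caps are exactly the labelled covers, then each point
corresponds to the minimal selector of its basic neighbourhoods. For restricted product covers of a
closed set `Y`, caps are covers (`isCap_iff_cover`) because every level is a band covering `Y` and,
by compactness, a deep enough level refines any given cover.

The combinatorial side uses coordinates. A cell is a position `k` on a leg `s`. If the centre of
every cell lies in `Y`, inclusion and overlap of restricted cells depend only on these coordinates.
When `Y` contains with each point the segment down to the root, each level is a spider. Its legs are
finite binary words, and passing to a finer level subdivides legs and splits them by extending the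
words. Such relations are morphisms of `𝐋` (`IsSpider.isMorL`). On the whole Cantor fan all legs of
a level have the same length, so ends go to ends and the morphisms lie in `𝐗`.

Composition is the delicate point: an inclusion of cells must factor through every intermediate
level. It can fail only where `Y` rises slightly above a coarse centre on some cylinder but misses
the next finer centre. Only finitely many pairs of cylinder and centre occur at each level, so the
next scale can be chosen fine enough to exclude this (`IsStarlike.exists_gap`).

A subfan `Y` is starlike since its ramification point has to be the root: at any other point two of
three arcs would leave along the same side of one spoke. -/

namespace FanSpec

namespace CantorFan

/-! ### Points of the Cantor fan -/

/-- The point of the Cantor fan at height `t` on the spoke `x`. -/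
noncomputable def pt (t : ℝ) (x : ℕ → Bool) : CantorFan :=
  mk (projIcc 0 1 zero_le_one t, x)

theorem mk_eq_mk {p q : unitInterval × (ℕ → Bool)} :
    mk p = mk q ↔ p = q ∨ (p.1 = 0 ∧ q.1 = 0) :=
  Quotient.eq (r := cantorFanSetoid)

theorem mk_eq_pt (p : unitInterval × (ℕ → Bool)) : mk p = pt p.1 p.2 := by
  simp [pt]

theorem exists_eq_pt (z : CantorFan) : ∃ t x, 0 ≤ t ∧ t ≤ 1 ∧ z = pt t x := by
  obtain ⟨p, rfl⟩ := Quotient.exists_rep z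
  exact ⟨p.1, p.2, p.1.2.1, p.1.2.2, mk_eq_pt p⟩

theorem pt_eq_pt {t t' : ℝ} {x x' : ℕ → Bool} (h0 : 0 ≤ t) (h1 : t ≤ 1) (h0' : 0 ≤ t')
    (h1' : t' ≤ 1) : pt t x = pt t' x' ↔ t = t' ∧ (t = 0 ∨ x = x') := by
  unfold pt
  rw [mk_eq_mk, projIcc_of_mem _ ⟨h0, h1⟩, projIcc_of_mem _ ⟨h0', h1'⟩]
  simp only [Prod.mk.injEq, Subtype.ext_iff, Icc.coe_zero]
  constructor
  · rintro (⟨rfl, rfl⟩ | ⟨rfl, rfl⟩) <;> simp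
  · rintro ⟨rfl, rfl | rfl⟩ <;> simp

theorem pt_zero (x x' : ℕ → Bool) : pt 0 x = pt 0 x' :=
  (pt_eq_pt le_rfl zero_le_one le_rfl zero_le_one).2 ⟨rfl, Or.inl rfl⟩

theorem height_pt {t : ℝ} {x : ℕ → Bool} (h0 : 0 ≤ t) (h1 : t ≤ 1) :
    ((pt t x).height : ℝ) = t := by
  change ((projIcc (0 : ℝ) 1 zero_le_one t : unitInterval) : ℝ) = t
  rw [projIcc_of_mem _ ⟨h0, h1⟩]

/-! ### The topology of the Cantor fan -/

theorem isOpen_iff {A : Set CantorFan} : IsOpen A ↔ IsOpen (mk ⁻¹' A) :=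
  isOpen_coinduced

/-- The set of points of the Cantor fan whose coordinates satisfy `Q`. -/
def sat (Q : ℝ → (ℕ → Bool) → Prop) : Set CantorFan :=
  {z | ∃ t x, 0 ≤ t ∧ t ≤ 1 ∧ z = pt t x ∧ Q t x}

theorem pt_mem_sat {Q : ℝ → (ℕ → Bool) → Prop} (hQ : ∀ x x', Q 0 x → Q 0 x') {t : ℝ}
    {x : ℕ → Bool} (h0 : 0 ≤ t) (h1 : t ≤ 1) : pt t x ∈ sat Q ↔ Q t x := by
  constructor
  · rintro ⟨t', x', h0', h1', h, hq⟩
    obtain ⟨rfl, rfl | rfl⟩ := (pt_eq_pt h0 h1 h0' h1').1 h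
    · exact hQ _ _ hq
    · exact hq
  · exact fun h => ⟨t, x, h0, h1, rfl, h⟩

theorem isOpen_sat {Q : ℝ → (ℕ → Bool) → Prop} (hQ : ∀ x x', Q 0 x → Q 0 x')
    (h : IsOpen {p : ℝ × (ℕ → Bool) | Q p.1 p.2}) : IsOpen (sat Q) := by
  rw [isOpen_iff]
  have hc : Continuous fun p : unitInterval × (ℕ → Bool) => ((p.1 : ℝ), p.2) := by fun_prop
  convert h.preimage hc using 1
  ext p
  rw [mem_preimage, mk_eq_pt, pt_mem_sat hQ p.1.2.1 p.1.2.2]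
  rfl

theorem isOpen_cylinder {b : ℕ} (s : Fin b → Bool) :
    IsOpen {p : ℝ × (ℕ → Bool) | ∀ i : Fin b, p.2 i = s i} := by
  simp only [ofPred_forall]
  refine isOpen_iInter_of_finite fun i => ?_
  exact (isOpen_discrete {s i}).preimage
    (f := fun p : ℝ × (ℕ → Bool) => p.2 i) (by fun_prop)

/-- The coordinates of an embedding of the Cantor fan in a product of lines. -/
noncomputable def coord : CantorFan → ℝ × (ℕ → ℝ) :=
  Quotient.lift (fun p : unitInterval × (ℕ → Bool) =>
    ((p.1 : ℝ), fun i => (p.1 : ℝ) * (if p.2 i then 1 else 0))) (by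
    rintro p q (rfl | ⟨h, h'⟩)
    · rfl
    · simp [h, h'])

theorem continuous_coord : Continuous coord := by
  refine Continuous.quotient_lift ?_ _
  refine Continuous.prodMk (by fun_prop) (continuous_pi fun i => ?_)
  refine Continuous.mul (by fun_prop) ?_
  exact (continuous_of_discreteTopology (f := fun c : Bool => if c then (1 : ℝ) else 0)).comp
    (by fun_prop)

/-- The spoke coordinates are multiplied by the height, so they vanish at the root; at positive
height, division recovers the spoke. -/
theorem coord_injective : Function.Injective coord := by
  intro z w h
  obtain ⟨⟨p, x⟩, rfl⟩ := Quotient.exists_rep z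
  obtain ⟨⟨q, y⟩, rfl⟩ := Quotient.exists_rep w
  simp only [coord, Quotient.lift_mk, Prod.mk.injEq] at h
  obtain ⟨h1, h2⟩ := h
  have hpq : p = q := Subtype.ext h1
  subst hpq
  refine mk_eq_mk.2 ?_
  by_cases hp : p = 0
  · exact Or.inr ⟨hp, hp⟩
  · refine Or.inl ?_
    congr 1
    funext i
    have hp' : (p : ℝ) ≠ 0 := fun h => hp (Subtype.ext h)
    have := mul_left_cancel₀ hp' (congrFun h2 i)
    cases hx : x i <;> cases hy : y i <;> simp_all

instance : T2Space CantorFan :=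
  T2Space.of_injective_continuous coord_injective continuous_coord

instance : CompactSpace CantorFan :=
  inferInstanceAs (CompactSpace (Quotient cantorFanSetoid))

/-- Open sets contain basic product neighbourhoods of their points. -/
theorem exists_prod_subset {W : Set CantorFan} (hW : IsOpen W) {t : ℝ} {y : ℕ → Bool}
    (h0 : 0 ≤ t) (h1 : t ≤ 1) (h : pt t y ∈ W) :
    ∃ ε > 0, ∃ n : ℕ, ∀ t' x, 0 ≤ t' → t' ≤ 1 → |t' - t| < ε → (∀ i : Fin n, x i = y i) →
      pt t' x ∈ W := by
  have hW' := isOpen_iff.1 hW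
  have hmem : ((⟨t, h0, h1⟩ : unitInterval), y) ∈ mk ⁻¹' W := by
    rw [mem_preimage, mk_eq_pt]; exact h
  obtain ⟨A, B, hA, hB, htA, hyB, hAB⟩ := isOpen_prod_iff.1 hW' _ _ hmem
  obtain ⟨ε, hε, hA'⟩ := Metric.isOpen_iff.1 hA _ htA
  obtain ⟨I, u, hu, hB'⟩ := isOpen_pi_iff.1 hB _ hyB
  refine ⟨ε, hε, I.sup id + 1, fun t' x h0' h1' ht' hx => ?_⟩
  have := hAB (show ((⟨t', h0', h1'⟩ : unitInterval), x) ∈ A ×ˢ B from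
    ⟨hA' ?_, hB' fun i hi => ?_⟩)
  · rwa [mem_preimage, mk_eq_pt] at this
  · rw [Metric.mem_ball, Subtype.dist_eq, Real.dist_eq]; exact ht'
  · have hi' : i < I.sup id + 1 := Nat.lt_succ_of_le (Finset.le_sup (f := id) hi)
    have := (hu i hi).2
    rwa [← hx ⟨i, hi'⟩] at this

/-- Open neighbourhoods of the root contain all points of small height. -/
theorem exists_height_subset {W : Set CantorFan} (hW : IsOpen W) {y : ℕ → Bool}
    (h : pt 0 y ∈ W) :
    ∃ ε > 0, ∀ t' x, 0 ≤ t' → t' ≤ 1 → t' < ε → pt t' x ∈ W := by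
  have hW' := isOpen_iff.1 hW
  have hsub : ({0} : Set unitInterval) ×ˢ (univ : Set (ℕ → Bool)) ⊆ mk ⁻¹' W := by
    rintro ⟨p, x⟩ ⟨hp, -⟩
    obtain rfl : p = 0 := hp
    rw [mem_preimage, mk_eq_pt]
    simpa [pt_zero x y] using h
  -- Compactness of `2^ω` yields one `ε` for all spokes.
  obtain ⟨A, B, hA, -, htA, hB, hAB⟩ :=
    generalized_tube_lemma isCompact_singleton isCompact_univ hW' hsub
  obtain ⟨ε, hε, hA'⟩ := Metric.isOpen_iff.1 hA 0 (htA rfl)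
  refine ⟨ε, hε, fun t' x h0' h1' ht' => ?_⟩
  have := hAB (show ((⟨t', h0', h1'⟩ : unitInterval), x) ∈ A ×ˢ B from
    ⟨hA' ?_, hB (mem_univ x)⟩)
  · rwa [mem_preimage, mk_eq_pt] at this
  · rw [Metric.mem_ball, Subtype.dist_eq, Real.dist_eq]
    simpa [abs_of_nonneg h0'] using ht'

end CantorFan

/-! ### A criterion for a space to be the spectrum of a poset -/

/-- The point `y` goes to `{p | y ∈ U p}`. Since caps are covers, these sets are selectors, they are
minimal, and every selector contains one of them, so they are all the minimal selectors. -/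
theorem spectrum_homeomorph {P Y : Type*} [PartialOrder P] [TopologicalSpace Y] [T1Space Y]
    (U : P → Set Y) (hU : ∀ p, IsOpen (U p))
    (hbasis : ∀ y : Y, ∀ W : Set Y, IsOpen W → y ∈ W → ∃ p, y ∈ U p ∧ U p ⊆ W)
    (hcap : ∀ C : Set P, IsCap C ↔ ∀ y, ∃ p ∈ C, y ∈ U p) :
    Nonempty (Spectrum P ≃ₜ Y) := by
  have hsel : ∀ y, IsSelector {p | y ∈ U p} := fun y C hC => by
    obtain ⟨p, hp, hy⟩ := (hcap C).1 hC y
    exact ⟨p, hy, hp⟩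
  have hmin : ∀ y, Minimal IsSelector {p | y ∈ U p} := fun y => by
    refine ⟨hsel y, fun T hT hTy p hp => ?_⟩
    by_contra hpT
    -- A cover in which only `p` contains `y`: a selector inside `{q | y ∈ U q}` can meet it only in
    -- `p`.
    have hC : IsCap ({q | y ∉ U q} ∪ {p}) := by
      refine (hcap _).2 fun z => ?_
      by_cases hz : z = y
      · exact ⟨p, Or.inr rfl, hz ▸ hp⟩
      · obtain ⟨q, hq, hq'⟩ := hbasis z {y}ᶜ isOpen_compl_singleton hz
        exact ⟨q, Or.inl fun h => hq' h rfl, hq⟩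
    obtain ⟨q, hqT, hq | hq⟩ := hT _ hC
    · exact hq (hTy hqT)
    · exact hpT (hq ▸ hqT)
  have hsup : ∀ T : Set P, IsSelector T → ∃ y, {p | y ∈ U p} ⊆ T := fun T hT => by
    -- Otherwise each point has a basic neighbourhood whose label is outside `T`, and these form a
    -- cover missed by `T`.
    by_contra! hcon
    choose p hp hpT using fun y => not_subset.1 (hcon y)
    obtain ⟨q, hq, y, rfl⟩ := hT (range p) ((hcap _).2 fun y => ⟨p y, ⟨y, rfl⟩, hp y⟩)
    exact hpT y hq
  let e : Y → Spectrum P := fun y => ⟨{p | y ∈ U p}, hmin y⟩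
  have he : Function.Bijective e := by
    refine ⟨fun y z hyz => ?_, fun T => ?_⟩
    · by_contra hne
      obtain ⟨p, hp, hp'⟩ := hbasis y {z}ᶜ isOpen_compl_singleton hne
      have : p ∈ (e z).1 := hyz ▸ (show p ∈ (e y).1 from hp)
      exact hp' this rfl
    · obtain ⟨y, hy⟩ := hsup T.1 T.2.1
      exact ⟨y, Subtype.ext (subset_antisymm hy (T.2.2 (hsel y) hy))⟩
  have hcont : Continuous e := by
    refine continuous_generateFrom_iff.2 ?_
    rintro _ ⟨p, rfl⟩
    exact hU p
  have hopen : IsOpenMap e := by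
    intro W hW
    have : e '' W = ⋃ p ∈ {p | U p ⊆ W}, {S : Spectrum P | p ∈ S.1} := by
      ext S
      simp only [mem_image, mem_iUnion, mem_ofPred_eq, exists_prop]
      constructor
      · rintro ⟨y, hy, rfl⟩
        obtain ⟨p, hp, hp'⟩ := hbasis y W hW hy
        exact ⟨p, hp', hp⟩
      · rintro ⟨p, hp, hpS⟩
        obtain ⟨y, rfl⟩ := he.2 S
        exact ⟨y, hp hpS, rfl⟩
    rw [this]
    exact isOpen_biUnion fun p _ => TopologicalSpace.isOpen_generateFrom_of_mem ⟨p, rfl⟩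
  exact ⟨((Equiv.ofBijective e he).toHomeomorphOfContinuousOpen hcont hopen).symm⟩

end FanSpec

namespace FanSpec

/-! ### Spiders: trees with legs indexed by `ι`, the leg `i` having length `K i` -/

/-- `G` is the graph obtained by glueing paths `v i 0, …, v i (K i)` at their first vertex. -/
structure IsSpider {V ι : Type} (G : SimpleGraph V) (K : ι → ℕ) (v : ι → ℕ → V) : Prop where
  surj : ∀ x, ∃ i k, k ≤ K i ∧ v i k = x
  eq_iff : ∀ {i j k l}, k ≤ K i → l ≤ K j → (v i k = v j l ↔ k = l ∧ (k = 0 ∨ i = j))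
  adj_iff : ∀ {i j k l}, k ≤ K i → l ≤ K j →
    (G.Adj (v i k) (v j l) ↔ (k = l + 1 ∧ (l = 0 ∨ i = j)) ∨ (l = k + 1 ∧ (k = 0 ∨ i = j)))
  three_legs : ∃ f : Fin 3 → ι, Function.Injective f ∧ ∀ m, 1 ≤ K (f m)

namespace IsSpider

variable {V ι : Type} {G : SimpleGraph V} {K : ι → ℕ} {v : ι → ℕ → V}

theorem zero_eq (hs : IsSpider G K v) (i j : ι) : v i 0 = v j 0 :=
  (hs.eq_iff (Nat.zero_le _) (Nat.zero_le _)).2 ⟨rfl, Or.inl rfl⟩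

theorem adj_succ (hs : IsSpider G K v) {i : ι} {k : ℕ} (hk : k + 1 ≤ K i) :
    G.Adj (v i k) (v i (k + 1)) :=
  (hs.adj_iff (by omega) hk).2 (Or.inr ⟨rfl, Or.inr rfl⟩)

theorem reachable_zero (hs : IsSpider G K v) (i : ι) {k : ℕ} (hk : k ≤ K i) :
    G.Reachable (v i 0) (v i k) := by
  induction k with
  | zero => rfl
  | succ k ih => exact (ih (by omega)).trans (hs.adj_succ hk).reachable

theorem connected (hs : IsSpider G K v) : G.Connected := by
  obtain ⟨f, -, -⟩ := hs.three_legs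
  rw [SimpleGraph.connected_iff_exists_forall_reachable]
  refine ⟨v (f 0) 0, fun x => ?_⟩
  obtain ⟨i, k, hk, rfl⟩ := hs.surj x
  rw [hs.zero_eq (f 0) i]
  exact hs.reachable_zero i hk

/-- A connected graph is a tree once it has fewer edges than vertices; every edge joins a non-root
vertex to its predecessor on the leg. -/
theorem isTree [Finite V] (hs : IsSpider G K v) : G.IsTree := by
  refine SimpleGraph.isTree_iff_connected_and_card.2 ⟨hs.connected, ?_⟩
  refine le_antisymm ?_ hs.connected.card_vert_le_card_edgeSet_add_one
  obtain ⟨f, -, -⟩ := hs.three_legs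
  have hpar : ∀ x : V, ∃ y, ∀ i k, k + 1 ≤ K i → v i (k + 1) = x → v i k = y := by
    intro x
    by_cases hx : ∃ i k, k + 1 ≤ K i ∧ v i (k + 1) = x
    · obtain ⟨i, k, hk, rfl⟩ := hx
      refine ⟨v i k, fun j l hl h => ?_⟩
      have := (hs.eq_iff hl hk).1 h
      exact (hs.eq_iff (by omega) (by omega)).2 (by simp_all)
    · push Not at hx
      -- The root has no predecessor; the value there is a dummy.
      exact ⟨x, fun i k hk h => absurd h (hx i k hk)⟩
  choose par hpar using hpar
  have hsub : G.edgeSet ⊆ (fun x => s(par x, x)) '' {v (f 0) 0}ᶜ := by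
    intro e
    induction e with
    | h x y =>
      intro hxy
      rw [SimpleGraph.mem_edgeSet] at hxy
      obtain ⟨i, k, hk, rfl⟩ := hs.surj x
      obtain ⟨j, l, hl, rfl⟩ := hs.surj y
      rcases (hs.adj_iff hk hl).1 hxy with ⟨rfl, h⟩ | ⟨rfl, h⟩
      · refine ⟨v i (l + 1), ?_, ?_⟩
        · simp [hs.eq_iff hk (Nat.zero_le _)]
        · simp only
          rw [← hpar _ i l hk rfl, Sym2.eq_swap, (hs.eq_iff (by omega) hl).2 ⟨rfl, h⟩]
      · refine ⟨v j (k + 1), ?_, ?_⟩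
        · simp [hs.eq_iff hl (Nat.zero_le _)]
        · simp only
          rw [← hpar _ j k hl rfl, (hs.eq_iff hk (by omega)).2 ⟨rfl, h⟩]
  have h1 := ncard_le_ncard hsub (toFinite _)
  have h2 := ncard_image_le (f := fun x => s(par x, x)) (toFinite ({v (f 0) 0}ᶜ : Set V))
  have h3 := ncard_add_ncard_compl ({v (f 0) 0} : Set V)
  rw [ncard_singleton] at h3
  rw [Nat.card_coe_set_eq]
  omega

theorem neighborSet_subset (hs : IsSpider G K v) {i : ι} {k : ℕ} (hk : k + 1 ≤ K i) :
    G.neighborSet (v i (k + 1)) ⊆ {v i k} ∪ {x | k + 2 ≤ K i ∧ x = v i (k + 2)} := by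
  intro x hx
  obtain ⟨j, l, hl, rfl⟩ := hs.surj x
  rcases (hs.adj_iff hk hl).1 hx with ⟨h, h'⟩ | ⟨rfl, h'⟩
  · obtain rfl : l = k := by omega
    exact Or.inl ((hs.eq_iff hl (by omega)).2 ⟨rfl, by tauto⟩)
  · obtain rfl : i = j := by simpa using h'
    exact Or.inr ⟨hl, rfl⟩

theorem isRoot_zero [Finite V] (hs : IsSpider G K v) (i : ι) : IsRoot G (v i 0) := by
  obtain ⟨f, hf, hK⟩ := hs.three_legs
  have hsub : range (fun m => v (f m) 1) ⊆ G.neighborSet (v i 0) := by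
    rintro _ ⟨m, rfl⟩
    exact (hs.adj_iff (Nat.zero_le _) (hK m)).2 (Or.inr ⟨rfl, Or.inl rfl⟩)
  have hinj : Function.Injective (fun m => v (f m) 1) := fun m m' h =>
    hf (by simpa using (hs.eq_iff (hK m) (hK m')).1 h)
  have := ncard_le_ncard hsub (toFinite _)
  rw [← image_univ, ncard_image_of_injective _ hinj, ncard_univ] at this
  simpa [IsRoot, deg] using this

theorem isRoot_iff [Finite V] (hs : IsSpider G K v) {i : ι} {k : ℕ} (hk : k ≤ K i) :
    IsRoot G (v i k) ↔ k = 0 := by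
  refine ⟨fun h => ?_, fun h => h ▸ hs.isRoot_zero i⟩
  by_contra hk0
  obtain ⟨k, rfl⟩ := Nat.exists_eq_succ_of_ne_zero hk0
  have hsub : G.neighborSet (v i (k + 1)) ⊆ {v i k, v i (k + 2)} := fun x hx => by
    rcases hs.neighborSet_subset hk hx with h | h
    · exact Or.inl h
    · exact Or.inr h.2
  have h1 := ncard_le_ncard hsub (toFinite _)
  have h2 := ncard_insert_le (v i k) {v i (k + 2)}
  rw [ncard_singleton] at h2
  have h3 : 3 ≤ (G.neighborSet (v i (k + 1))).ncard := h
  omega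

theorem isEnd_iff [Finite V] (hs : IsSpider G K v) {i : ι} {k : ℕ} (hk : k ≤ K i) :
    IsEnd G (v i k) ↔ 0 < k ∧ k = K i := by
  constructor
  · intro h
    have h0 : 0 < k := by
      rw [Nat.pos_iff_ne_zero]
      rintro rfl
      have h3 : 3 ≤ deg G (v i 0) := hs.isRoot_zero i
      have h1 : deg G (v i 0) ≤ 1 := h
      omega
    refine ⟨h0, ?_⟩
    by_contra hne
    obtain ⟨k, rfl⟩ := Nat.exists_eq_succ_of_ne_zero h0.ne'
    have hsub : {v i k, v i (k + 2)} ⊆ G.neighborSet (v i (k + 1)) := by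
      rintro x (rfl | rfl)
      · exact (hs.adj_succ hk).symm
      · exact hs.adj_succ (by omega)
    have h1 := ncard_le_ncard hsub (toFinite _)
    rw [ncard_pair (fun h => by
      have := (hs.eq_iff (by omega) (by omega)).1 h
      omega)] at h1
    have h2 : (G.neighborSet (v i (k + 1))).ncard ≤ 1 := h
    omega
  · rintro ⟨h0, h⟩
    obtain ⟨k, rfl⟩ := Nat.exists_eq_succ_of_ne_zero h0.ne'
    have hsub : G.neighborSet (v i (k + 1)) ⊆ {v i k} := fun x hx => by
      rcases hs.neighborSet_subset hk hx with h' | h'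
      · exact h'
      · have := h'.1
        omega
    have h1 := ncard_le_ncard hsub (toFinite _)
    rwa [ncard_singleton] at h1

theorem isGraphFan [Finite V] (hs : IsSpider G K v) : IsGraphFan G := by
  refine ⟨hs.isTree, ?_⟩
  obtain ⟨f, -, -⟩ := hs.three_legs
  refine ⟨v (f 0) 0, hs.isRoot_zero _, fun x hx => ?_⟩
  obtain ⟨i, k, hk, rfl⟩ := hs.surj x
  obtain rfl := (hs.isRoot_iff hk).1 hx
  exact hs.zero_eq _ _

theorem exists_path (hs : IsSpider G K v) (i : ι) {k : ℕ} (hk : k ≤ K i) :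
    ∃ p : G.Walk (v i 0) (v i k), p.IsPath ∧ ∀ x, x ∈ p.support ↔ ∃ l ≤ k, v i l = x := by
  induction k with
  | zero => exact ⟨SimpleGraph.Walk.nil, by simp, by simp [eq_comm]⟩
  | succ k ih =>
    obtain ⟨p, hp, hsup⟩ := ih (by omega)
    refine ⟨p.concat (hs.adj_succ hk), hp.concat ?_ _, fun x => ?_⟩
    · rw [hsup]
      rintro ⟨l, hl, h⟩
      have := (hs.eq_iff (by omega) hk).1 h
      omega
    · rw [SimpleGraph.Walk.support_concat]
      simp only [List.mem_append, hsup, List.mem_singleton]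
      constructor
      · rintro (⟨l, hl, rfl⟩ | rfl)
        · exact ⟨l, by omega, rfl⟩
        · exact ⟨k + 1, le_rfl, rfl⟩
      · rintro ⟨l, hl, rfl⟩
        rcases Nat.lt_or_eq_of_le hl with h | rfl
        · exact Or.inl ⟨l, by omega, rfl⟩
        · exact Or.inr rfl

/-- Paths in a tree are unique, so the spokes are the legs. A leg of length `0` is just the root and
contributes none. -/
theorem isSpoke_iff [Finite V] (hs : IsSpider G K v) {S : Set V} :
    IsSpoke G S ↔ ∃ i, 1 ≤ K i ∧ S = {x | ∃ k ≤ K i, v i k = x} := by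
  constructor
  · rintro ⟨r, e, hr, he, p, hp, rfl⟩
    obtain ⟨i, k, hk, rfl⟩ := hs.surj e
    obtain ⟨j, l, hl, rfl⟩ := hs.surj r
    obtain rfl := (hs.isRoot_iff hl).1 hr
    obtain ⟨h0, rfl⟩ := (hs.isEnd_iff hk).1 he
    refine ⟨i, h0, ?_⟩
    obtain ⟨q, hq, hsup⟩ := hs.exists_path i hk
    revert p
    rw [hs.zero_eq j i]
    intro p hp
    have := (hs.isTree.isAcyclic.subsingleton_path _ _).elim ⟨p, hp⟩ ⟨q, hq⟩
    obtain rfl : p = q := congrArg Subtype.val this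
    ext x
    exact hsup x
  · rintro ⟨i, hi, rfl⟩
    obtain ⟨q, hq, hsup⟩ := hs.exists_path i le_rfl
    exact ⟨_, _, hs.isRoot_zero i, (hs.isEnd_iff le_rfl).2 ⟨hi, rfl⟩, q, hq,
      Set.ext fun x => (hsup x).symm⟩

theorem connectedSet_of_ordConnected (hs : IsSpider G K v) (i : ι) {P : ℕ → Prop}
    (hP : ∀ a b c, P a → P b → a ≤ c → c ≤ b → P c) :
    ConnectedSet G {x | ∃ k ≤ K i, v i k = x ∧ P k} := by
  have key : ∀ d a (ha : a ≤ K i) (hPa : P a) (hb : a + d ≤ K i) (hPb : P (a + d)),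
      (G.induce {x | ∃ k ≤ K i, v i k = x ∧ P k}).Reachable ⟨v i a, a, ha, rfl, hPa⟩
        ⟨v i (a + d), _, hb, rfl, hPb⟩ := by
    intro d
    induction d with
    | zero => exact fun a _ _ _ _ => SimpleGraph.Reachable.refl _
    | succ d ih =>
      intro a ha hPa hb hPb
      refine (ih a ha hPa (by omega) (hP _ _ _ hPa hPb (by omega) (by omega))).trans ?_
      refine SimpleGraph.Adj.reachable ?_
      rw [SimpleGraph.comap_adj]
      exact hs.adj_succ hb
  rintro ⟨_, a, ha, rfl, hPa⟩ ⟨_, b, hb, rfl, hPb⟩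
  rcases le_total a b with h | h
  · obtain ⟨d, rfl⟩ := Nat.exists_eq_add_of_le h
    exact key d a ha hPa hb hPb
  · obtain ⟨d, rfl⟩ := Nat.exists_eq_add_of_le h
    exact (key d b hb hPb ha hPa).symm

theorem ordConnected_of_connectedSet (hs : IsSpider G K v) {i : ι} {C : Set V}
    (hC : C ⊆ {x | ∃ k ≤ K i, v i k = x}) (hconn : ConnectedSet G C) {a b c : ℕ} (hb : b ≤ K i)
    (hac : a ≤ c) (hcb : c ≤ b) (haC : v i a ∈ C) (hbC : v i b ∈ C) : v i c ∈ C := by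
  by_contra hcC
  -- Positions change by one along a walk, so a walk avoiding position `c` cannot leave the
  -- positions below `c`.
  have key : ∀ x y : C, ∀ w : (G.induce C).Walk x y, (∃ k < c, v i k = x) →
      ∃ k < c, v i k = y := by
    intro x y w
    induction w with
    | nil => exact id
    | @cons x z y hxz w ih =>
      rintro ⟨k, hk, hkx⟩
      refine ih ?_
      obtain ⟨l, hl, hlz⟩ := hC z.2
      have hadj : G.Adj x z := hxz
      rw [← hkx, ← hlz, hs.adj_iff (by omega) hl] at hadj
      refine ⟨l, ?_, hlz⟩
      rcases hadj with h | h
      · omega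
      · have : l ≠ c := by
          rintro rfl
          exact hcC (hlz ▸ z.2)
        omega
  have hac' : a < c := lt_of_le_of_ne hac (by rintro rfl; exact hcC haC)
  obtain ⟨w⟩ := hconn ⟨_, haC⟩ ⟨_, hbC⟩
  obtain ⟨k, hk, h⟩ := key _ _ w ⟨a, hac', rfl⟩
  have := (hs.eq_iff (by omega) hb).1 h
  omega

end IsSpider

/-! ### Relations between spiders given by subdivision of the legs -/

section SpiderMor

variable {V W ι κ : Type} {H : SimpleGraph V} {G : SimpleGraph W} {K : ι → ℕ} {K' : κ → ℕ}
  {v : ι → ℕ → V} {v' : κ → ℕ → W} {π : κ → ι} {N : ℕ} {R : V → W → Prop}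

/-- The open integer intervals of radius `N` about consecutive multiples of `N` leave no gap, so
their union over a convex set of `k` is convex. The witness is `c / N`, clipped to the range spanned
by the two given values. -/
theorem ordConnected_subdivision {Q : ℕ → Prop}
    (hQ : ∀ a b c, Q a → Q b → a ≤ c → c ≤ b → Q c) (hN : 1 ≤ N) {a b c : ℕ}
    (ha : ∃ k, Q k ∧ k * N < a + N ∧ a < k * N + N)
    (hb : ∃ k, Q k ∧ k * N < b + N ∧ b < k * N + N) (hac : a ≤ c) (hcb : c ≤ b) :
    ∃ k, Q k ∧ k * N < c + N ∧ c < k * N + N := by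
  obtain ⟨k₁, hQ₁, h₁, h₁'⟩ := ha
  obtain ⟨k₂, hQ₂, h₂, h₂'⟩ := hb
  have hq := Nat.div_mul_le_self c N
  have hq' := Nat.lt_div_mul_add (a := c) (b := N) hN
  rcases le_or_gt k₁ k₂ with h | h
  · rcases lt_or_ge (c / N) k₁ with h' | h'
    · have := Nat.mul_le_mul_right N (Nat.succ_le_of_lt h')
      rw [Nat.succ_mul] at this
      exact ⟨k₁, hQ₁, by omega, by omega⟩
    · rcases lt_or_ge k₂ (c / N) with h'' | h''
      · have := Nat.mul_le_mul_right N (Nat.succ_le_of_lt h'')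
        rw [Nat.succ_mul] at this
        omega
      · exact ⟨c / N, hQ _ _ _ hQ₁ hQ₂ h' h'', by omega, by omega⟩
  · have := Nat.mul_le_mul_right N (Nat.succ_le_of_lt h)
    rw [Nat.succ_mul] at this
    exact ⟨k₂, hQ₂, by omega, by omega⟩

/-- Position `k` of `H` sits at position `k * N` of `G` and is related to everything strictly within
`N` of it; `π` tells which leg of `H` a leg of `G` refines. `hfloor` supplies a related vertex for
each `l`, and `hlift` a copy of each vertex of `H` in `G`. -/
theorem IsSpider.isMorL [Finite V] [Finite W] (hs : IsSpider H K v) (hs' : IsSpider G K' v')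
    (hN : 1 ≤ N) (hep : EdgePreserving H G R)
    (hR : ∀ {i j k l}, k ≤ K i → l ≤ K' j →
      (R (v i k) (v' j l) ↔ (k = 0 ∨ i = π j) ∧ k * N < l + N ∧ l < k * N + N))
    (hfloor : ∀ {j l k}, l ≤ K' j → k * N ≤ l → k ≤ K (π j))
    (hlift : ∀ {i k}, k ≤ K i → ∃ j, (k = 0 ∨ i = π j) ∧ k * N ≤ K' j) :
    IsMorL H G R := by
  have hle : ∀ {k l : ℕ}, k * N < l * N + N → k ≤ l := fun {k l} h => by
    rw [← Nat.succ_mul] at h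
    exact Nat.lt_succ_iff.1 (Nat.lt_of_mul_lt_mul_right h)
  refine ⟨hep, fun h => ?_, fun g => ?_, fun r hr h => ?_, fun S hS => ?_⟩
  · obtain ⟨i, k, hk, rfl⟩ := hs.surj h
    obtain ⟨j, hj, hkj⟩ := hlift hk
    -- Distinct multiples of `N` are at least `N` apart, so position `k * N` sees only `k`.
    refine ⟨v' j (k * N), fun h' => ?_⟩
    obtain ⟨i', k', hk', rfl⟩ := hs.surj h'
    rw [hR hk' hkj, hs.eq_iff hk' hk]
    constructor
    · rintro ⟨h1, h2, h3⟩
      obtain rfl := le_antisymm (hle h2) (hle h3)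
      refine ⟨rfl, ?_⟩
      rcases h1 with h1 | h1
      · exact Or.inl h1
      · rcases hj with hj | hj
        · exact Or.inl hj
        · exact Or.inr (h1.trans hj.symm)
    · rintro ⟨rfl, h⟩
      refine ⟨?_, by omega, by omega⟩
      rcases h with h | rfl
      · exact Or.inl h
      · exact hj
  · obtain ⟨j, l, hl, rfl⟩ := hs'.surj g
    have hq := Nat.div_mul_le_self l N
    have hq' := Nat.lt_div_mul_add (a := l) (b := N) hN
    exact ⟨v (π j) (l / N), (hR (hfloor hl hq) hl).2 ⟨Or.inr rfl, by omega, hq'⟩⟩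
  · obtain ⟨j, l, hl, rfl⟩ := hs'.surj r
    obtain rfl := (hs'.isRoot_iff hl).1 hr
    obtain ⟨i, k, hk, rfl⟩ := hs.surj h
    rw [hR hk hl, hs.isRoot_iff hk]
    constructor
    · rintro ⟨-, h, -⟩
      exact Nat.le_zero.1 (hle (by simpa using h))
    · rintro rfl
      exact ⟨Or.inl rfl, by omega, by omega⟩
  · obtain ⟨j, -, rfl⟩ := hs'.isSpoke_iff.1 hS
    have himage : ∀ g ∈ {x | ∃ l ≤ K' j, v' j l = x}, ∀ h, R h g →
        ∃ k ≤ K (π j), v (π j) k = h := by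
      rintro _ ⟨l, hl, rfl⟩ h hh
      obtain ⟨i, k, hk, rfl⟩ := hs.surj h
      obtain ⟨rfl | rfl, -⟩ := (hR hk hl).1 hh
      · exact ⟨0, Nat.zero_le _, hs.zero_eq _ _⟩
      · exact ⟨k, hk, rfl⟩
    have hmono : ∀ T : Set V,
        (∀ C ⊆ T, ConnectedSet H C → ∀ a b c, (a ≤ K (π j) ∧ v (π j) a ∈ C) →
          (b ≤ K (π j) ∧ v (π j) b ∈ C) → a ≤ c → c ≤ b → (c ≤ K (π j) ∧ v (π j) c ∈ C)) →
        MonotoneOn H G R T {x | ∃ l ≤ K' j, v' j l = x} := by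
      intro T hT C hCT hC
      have : {g ∈ {x | ∃ l ≤ K' j, v' j l = x} | ∃ h ∈ C, R h g} =
          {x | ∃ l ≤ K' j, v' j l = x ∧ ∃ k, (k ≤ K (π j) ∧ v (π j) k ∈ C) ∧
            k * N < l + N ∧ l < k * N + N} := by
        ext x
        constructor
        · rintro ⟨⟨l, hl, rfl⟩, h, hh, hRh⟩
          obtain ⟨k, hk, rfl⟩ := himage _ ⟨l, hl, rfl⟩ h hRh
          exact ⟨l, hl, rfl, k, ⟨hk, hh⟩, ((hR hk hl).1 hRh).2⟩
        · rintro ⟨l, hl, rfl, k, ⟨hk, hkC⟩, h⟩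
          exact ⟨⟨l, hl, rfl⟩, _, hkC, (hR hk hl).2 ⟨Or.inr rfl, h⟩⟩
      rw [this]
      exact hs'.connectedSet_of_ordConnected j fun a b c ha hb hac hcb =>
        ordConnected_subdivision (hT C hCT hC) hN ha hb hac hcb
    -- If the target leg has length `0` it is no spoke, but then the whole leg `j` maps to the root
    -- and any spoke serves.
    rcases Nat.eq_zero_or_pos (K (π j)) with h0 | h0
    · obtain ⟨f, -, hf⟩ := hs.three_legs
      refine ⟨_, hs.isSpoke_iff.2 ⟨f 0, hf 0, rfl⟩, fun g hg h hh => ?_, hmono _ ?_⟩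
      · obtain ⟨k, hk, rfl⟩ := himage g hg h hh
        obtain rfl : k = 0 := by omega
        exact ⟨0, Nat.zero_le _, hs.zero_eq _ _⟩
      · rintro C - - a b c ⟨ha, haC⟩ ⟨hb, -⟩ hac hcb
        obtain rfl : c = a := by omega
        exact ⟨ha, haC⟩
    · refine ⟨_, hs.isSpoke_iff.2 ⟨π j, h0, rfl⟩, himage, hmono _ ?_⟩
      rintro C hCT hC a b c ⟨ha, haC⟩ ⟨hb, hbC⟩ hac hcb
      exact ⟨by omega, hs.ordConnected_of_connectedSet hCT hC hb hac hcb haC hbC⟩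

/-- With equal leg lengths in `H` and legs exactly `N` times as long in `G`, the last position of
`G` is a multiple of `N` and hence related only to last positions of `H`. -/
theorem IsSpider.endPreserving [Finite V] [Finite W] (hs : IsSpider H K v)
    (hs' : IsSpider G K' v')
    (hR : ∀ {i j k l}, k ≤ K i → l ≤ K' j →
      (R (v i k) (v' j l) ↔ (k = 0 ∨ i = π j) ∧ k * N < l + N ∧ l < k * N + N))
    (hK : ∀ j, K' j = K (π j) * N) (hK' : ∀ i j, K i = K j) (hpos : ∀ i, 0 < K i) :
    EndPreserving H G R := by
  intro e he h hh
  obtain ⟨j, l, hl, rfl⟩ := hs'.surj e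
  obtain ⟨h0, rfl⟩ := (hs'.isEnd_iff hl).1 he
  obtain ⟨i, k, hk, rfl⟩ := hs.surj h
  obtain ⟨-, -, h2⟩ := (hR hk hl).1 hh
  rw [hK j, ← hK' i, ← Nat.succ_mul] at h2
  have := Nat.lt_of_mul_lt_mul_right h2
  obtain rfl : k = K i := by omega
  exact (hs.isEnd_iff le_rfl).2 ⟨hpos i, rfl⟩

end SpiderMor

end FanSpec

namespace FanSpec

open CantorFan

/-! ### Cells in coordinates -/

/-- The cell with centre `k / 2 ^ a` over the cylinder of `s`; the central cell if `k = 0`. -/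
def cell (a : ℕ) {b : ℕ} (s : Fin b → Bool) (k : ℕ) : Set CantorFan :=
  if k = 0 then fanCell a 0 (Fin.elim0 : Fin 0 → Bool) else fanCell a k s

/-- The first entries of a finite sequence. -/
def restr {b b' : ℕ} (h : b ≤ b') (s : Fin b' → Bool) : Fin b → Bool :=
  fun i => s (Fin.castLE h i)

variable {a b c k l : ℕ} {s : Fin b → Bool} {Y : Set CantorFan} {t : ℝ} {x : ℕ → Bool}

theorem fanCell_eq_sat (a k : ℕ) {b : ℕ} (s : Fin b → Bool) :
    fanCell a k s = sat fun t x => ((k : ℝ) - 1) / 2 ^ a < t ∧ t < ((k : ℝ) + 1) / 2 ^ a ∧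
      ∀ i : Fin b, x i = s i := by
  ext z
  constructor
  · rintro ⟨p, hp, rfl⟩
    exact ⟨p.1, p.2, p.1.2.1, p.1.2.2, mk_eq_pt p, hp⟩
  · rintro ⟨t, x, h0, h1, rfl, h⟩
    exact ⟨(⟨t, h0, h1⟩, x), h, mk_eq_pt _⟩

theorem cell_eq_sat (a : ℕ) {b : ℕ} (s : Fin b → Bool) (k : ℕ) :
    cell a s k = sat fun t x => (k : ℝ) < t * 2 ^ a + 1 ∧ t * 2 ^ a < (k : ℝ) + 1 ∧
      (k = 0 ∨ ∀ i : Fin b, x i = s i) := by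
  unfold cell
  have h2 : (0 : ℝ) < 2 ^ a := by positivity
  split_ifs with hk
  · subst hk
    rw [fanCell_eq_sat]
    congr! 4
    · rw [div_lt_iff₀ h2, sub_lt_iff_lt_add]
    · rw [lt_div_iff₀ h2]
      simp
  · rw [fanCell_eq_sat]
    congr! 4
    · rw [div_lt_iff₀ h2, sub_lt_iff_lt_add]
    · rw [lt_div_iff₀ h2]
      simp [hk]

/-- At height `0` the first inequality forces `k = 0`, so the spoke is irrelevant, as the quotient
requires. -/
theorem cell_respects (a k : ℕ) {b : ℕ} (s : Fin b → Bool) (x x' : ℕ → Bool) :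
    ((k : ℝ) < 0 * 2 ^ a + 1 ∧ 0 * 2 ^ a < (k : ℝ) + 1 ∧ (k = 0 ∨ ∀ i : Fin b, x i = s i)) →
    ((k : ℝ) < 0 * 2 ^ a + 1 ∧ 0 * 2 ^ a < (k : ℝ) + 1 ∧ (k = 0 ∨ ∀ i : Fin b, x' i = s i)) := by
  rintro ⟨h, h', -⟩
  have : k < 1 := by exact_mod_cast (by simpa using h : (k : ℝ) < 1)
  exact ⟨h, h', Or.inl (by omega)⟩

theorem pt_mem_cell (h0 : 0 ≤ t) (h1 : t ≤ 1) :
    pt t x ∈ cell a s k ↔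
      (k : ℝ) < t * 2 ^ a + 1 ∧ t * 2 ^ a < (k : ℝ) + 1 ∧ (k = 0 ∨ ∀ i : Fin b, x i = s i) := by
  rw [cell_eq_sat, pt_mem_sat (cell_respects a k s) h0 h1]

theorem isOpen_cell (a : ℕ) {b : ℕ} (s : Fin b → Bool) (k : ℕ) : IsOpen (cell a s k) := by
  rw [cell_eq_sat]
  refine isOpen_sat (cell_respects a k s) ?_
  have h1 : IsOpen {p : ℝ × (ℕ → Bool) | (k : ℝ) < p.1 * 2 ^ a + 1} :=
    isOpen_lt (by fun_prop) (by fun_prop)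
  have h2 : IsOpen {p : ℝ × (ℕ → Bool) | p.1 * 2 ^ a < (k : ℝ) + 1} :=
    isOpen_lt (by fun_prop) (by fun_prop)
  exact h1.inter (h2.inter (isOpen_const.union (isOpen_cylinder s)))

theorem isFanCell_iff {g : Set CantorFan} :
    IsFanCell a b k g ↔ k ≤ 2 ^ a ∧ ∃ s : Fin b → Bool, g = cell a s k := by
  unfold IsFanCell cell
  rcases Nat.eq_zero_or_pos k with rfl | hk
  · simp
  · simp [hk, hk.ne']

theorem exists_extension (s : Fin b → Bool) : ∃ x : ℕ → Bool, ∀ i : Fin b, x i = s i :=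
  ⟨fun n => if h : n < b then s ⟨n, h⟩ else false, fun i => by simp⟩

/-- The set `Y` meets the spokes of the cylinder of `s` at height `k / 2 ^ a`. -/
def Reach (Y : Set CantorFan) (a : ℕ) {b : ℕ} (s : Fin b → Bool) (k : ℕ) : Prop :=
  k ≤ 2 ^ a ∧ ∃ x : ℕ → Bool, (∀ i : Fin b, x i = s i) ∧ pt ((k : ℝ) / 2 ^ a) x ∈ Y

theorem div_two_pow_le_one (h : k ≤ 2 ^ a) : (k : ℝ) / 2 ^ a ≤ 1 := by
  rw [div_le_one (by positivity)]
  exact_mod_cast h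

theorem center_mem_cell (hk : k ≤ 2 ^ a) (hx : ∀ i : Fin b, x i = s i) :
    pt ((k : ℝ) / 2 ^ a) x ∈ cell a s k := by
  rw [pt_mem_cell (by positivity) (div_two_pow_le_one hk), div_mul_cancel₀ _ (by positivity)]
  exact ⟨by linarith, by linarith, Or.inr hx⟩

theorem mem_restrictedCover {h : Set CantorFan} :
    h ∈ restrictedCover a b Y ↔ ∃ (s : Fin b → Bool) (k : ℕ), Reach Y a s k ∧
      h = cell a s k ∩ Y := by
  constructor
  · rintro ⟨k, g, hg, ⟨z, ⟨hzg, hzY⟩, hz⟩, rfl⟩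
    obtain ⟨hk, s, rfl⟩ := isFanCell_iff.1 hg
    obtain ⟨t, x, h0, h1, rfl⟩ := exists_eq_pt z
    rw [height_pt h0 h1] at hz
    subst hz
    obtain ⟨-, -, rfl | hx⟩ := (pt_mem_cell h0 h1).1 hzg
    · exact ⟨fun i => x i, 0, ⟨hk, x, fun _ => rfl, hzY⟩, rfl⟩
    · exact ⟨s, k, ⟨hk, x, hx, hzY⟩, rfl⟩
  · rintro ⟨s, k, ⟨hk, x, hx, hY⟩, rfl⟩
    exact ⟨k, _, isFanCell_iff.2 ⟨hk, s, rfl⟩, ⟨_, ⟨center_mem_cell hk hx, hY⟩,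
      height_pt (by positivity) (div_two_pow_le_one hk)⟩, rfl⟩

theorem reach_univ : Reach univ a s k ↔ k ≤ 2 ^ a := by
  obtain ⟨x, hx⟩ := exists_extension s
  exact ⟨fun h => h.1, fun h => ⟨h, x, hx, mem_univ _⟩⟩

theorem restrictedCover_univ (a b : ℕ) : restrictedCover a b univ = fanCover a b := by
  ext g
  rw [mem_restrictedCover]
  simp only [reach_univ, inter_univ]
  constructor
  · rintro ⟨s, k, hk, rfl⟩
    exact ⟨k, isFanCell_iff.2 ⟨hk, s, rfl⟩⟩
  · rintro ⟨k, h⟩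
    obtain ⟨hk, s, rfl⟩ := isFanCell_iff.1 h
    exact ⟨s, k, hk, rfl⟩

/-- Inclusion of cells in coordinates. -/
theorem cell_inter_subset_iff {b' a' : ℕ} {s' : Fin b' → Bool} (hb : b ≤ b') (ha : a' = a + c)
    (hl : Reach Y a' s' l) :
    cell a' s' l ∩ Y ⊆ cell a s k ∩ Y ↔
      (k = 0 ∨ s = restr hb s') ∧ k * 2 ^ c < l + 2 ^ c ∧ l < k * 2 ^ c + 2 ^ c := by
  subst ha
  have hc : (0 : ℝ) < 2 ^ c := by positivity
  constructor
  · intro h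
    obtain ⟨hl1, x, hx, hxY⟩ := hl
    -- Inclusion is tested at the centre of the small cell, which lies in `Y` by `Reach`.
    have hmem := (h ⟨center_mem_cell hl1 hx, hxY⟩).1
    have hcalc : (l : ℝ) / 2 ^ (a + c) * 2 ^ a = l / 2 ^ c := by
      rw [pow_add]; field_simp
    rw [pt_mem_cell (by positivity) (div_two_pow_le_one hl1), hcalc] at hmem
    obtain ⟨h1, h2, h3⟩ := hmem
    refine ⟨h3.imp_right fun h3 => funext fun i => ?_, ?_, ?_⟩
    · exact (h3 i).symm.trans (hx (Fin.castLE hb i))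
    · have : (k : ℝ) * 2 ^ c < l + 2 ^ c := by
        rwa [← sub_lt_iff_lt_add, lt_div_iff₀ hc, sub_mul, one_mul, sub_lt_iff_lt_add] at h1
      exact_mod_cast this
    · have : (l : ℝ) < k * 2 ^ c + 2 ^ c := by
        rwa [div_lt_iff₀ hc, add_mul, one_mul] at h2
      exact_mod_cast this
  · rintro ⟨h1, h2, h3⟩ z ⟨hz, hzY⟩
    refine ⟨?_, hzY⟩
    obtain ⟨t, x, ht0, ht1, rfl⟩ := exists_eq_pt z
    rw [pt_mem_cell ht0 ht1] at hz ⊢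
    obtain ⟨hz1, hz2, hz3⟩ := hz
    rw [pow_add, ← mul_assoc] at hz1 hz2
    -- Strictness between integers gains `1`, the radius of the small cell in units of the fine
    -- scale.
    have h2' : (k : ℝ) * 2 ^ c + 1 ≤ l + 2 ^ c := by exact_mod_cast h2
    have h3' : (l : ℝ) + 1 ≤ k * 2 ^ c + 2 ^ c := by exact_mod_cast h3
    refine ⟨?_, ?_, ?_⟩
    · refine lt_of_mul_lt_mul_right (a := (2 : ℝ) ^ c) ?_ hc.le
      rw [add_mul, one_mul]
      linarith
    · refine lt_of_mul_lt_mul_right (a := (2 : ℝ) ^ c) ?_ hc.le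
      rw [add_mul, one_mul]
      linarith
    · rcases Nat.eq_zero_or_pos k with rfl | hk
      · exact Or.inl rfl
      right
      have hl0 : l ≠ 0 := by
        rintro rfl
        have := Nat.le_mul_of_pos_left (2 ^ c) hk
        omega
      obtain rfl := h1.resolve_left hk.ne'
      exact fun i => (hz3.resolve_left hl0) (Fin.castLE hb i)

theorem cell_inter_eq_iff {s' : Fin b → Bool} (hk : Reach Y a s k) (hl : Reach Y a s' l) :
    cell a s k ∩ Y = cell a s' l ∩ Y ↔ k = l ∧ (k = 0 ∨ s = s') := by
  constructor
  · intro h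
    have h1 := (cell_inter_subset_iff (c := 0) le_rfl rfl hl).1 h.ge
    have h2 := (cell_inter_subset_iff (c := 0) le_rfl rfl hk).1 h.le
    simp only [pow_zero, mul_one] at h1 h2
    exact ⟨by omega, h1.1⟩
  · rintro ⟨rfl, rfl | rfl⟩
    · simp [cell]
    · rfl

/-! ### Starlike sets and the legs of their restricted covers -/

/-- A set containing with each point the segment from the root to it. -/
structure IsStarlike (Y : Set CantorFan) : Prop where
  closed : IsClosed Y
  root_mem : ∀ x, pt 0 x ∈ Y
  down : ∀ {t t' x}, 0 ≤ t → t ≤ t' → t' ≤ 1 → pt t' x ∈ Y → pt t x ∈ Y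

theorem isStarlike_univ : IsStarlike univ :=
  ⟨isClosed_univ, fun _ => mem_univ _, fun _ _ _ _ => mem_univ _⟩

namespace IsStarlike

theorem reach_zero (hY : IsStarlike Y) (a : ℕ) (s : Fin b → Bool) : Reach Y a s 0 := by
  obtain ⟨x, hx⟩ := exists_extension s
  exact ⟨Nat.zero_le _, x, hx, by simpa using hY.root_mem x⟩

theorem reach_of_mem (hY : IsStarlike Y) (ht : t ≤ 1) (hx : ∀ i : Fin b, x i = s i)
    (hmem : pt t x ∈ Y) (h : (k : ℝ) / 2 ^ a ≤ t) : Reach Y a s k := by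
  refine ⟨?_, x, hx, hY.down (by positivity) h ht hmem⟩
  have := h.trans ht
  rw [div_le_one (by positivity)] at this
  exact_mod_cast this

theorem reach_mono (hY : IsStarlike Y) (h : k ≤ l) (hl : Reach Y a s l) : Reach Y a s k := by
  obtain ⟨hl, x, hx, hxY⟩ := hl
  refine hY.reach_of_mem (div_two_pow_le_one hl) hx hxY ?_
  have : (k : ℝ) ≤ l := by exact_mod_cast h
  gcongr

theorem reach_floor (hY : IsStarlike Y) {b' a' : ℕ} {s' : Fin b' → Bool} (hb : b ≤ b')
    (ha : a' = a + c) (hl : Reach Y a' s' l) (h : k * 2 ^ c ≤ l) :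
    Reach Y a (restr hb s') k := by
  subst ha
  obtain ⟨hl, x, hx, hxY⟩ := hl
  refine hY.reach_of_mem (div_two_pow_le_one hl) (fun i => hx (Fin.castLE hb i)) hxY ?_
  have : (k : ℝ) * 2 ^ c ≤ l := by exact_mod_cast h
  rw [pow_add, div_le_div_iff₀ (by positivity) (by positivity)]
  nlinarith [pow_pos (zero_lt_two (α := ℝ)) a]

/-- The length of the leg `s` of the graph of the cover restricted to `Y`. -/
noncomputable def len (Y : Set CantorFan) (a : ℕ) (s : Fin b → Bool) : ℕ := by
  classical exact Nat.findGreatest (Reach Y a s) (2 ^ a)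

/-- Starlikeness makes `Reach` downward closed, so the retained centres on a leg form an initial
segment. -/
theorem le_len_iff (hY : IsStarlike Y) : k ≤ len Y a s ↔ Reach Y a s k := by
  classical
  constructor
  · intro h
    refine hY.reach_mono h ?_
    unfold len
    convert Nat.findGreatest_spec (P := Reach Y a s) (Nat.zero_le (2 ^ a)) (hY.reach_zero a s)
  · intro h
    unfold len
    convert Nat.le_findGreatest h.1 h

theorem overlap_succ (hY : IsStarlike Y) {s' : Fin b → Bool} (h : Reach Y a s' (k + 1))
    (hs : k = 0 ∨ s = s') : (cell a s k ∩ Y ∩ (cell a s' (k + 1) ∩ Y)).Nonempty := by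
  obtain ⟨hk, x, hx, hxY⟩ := h
  have h2 : (0 : ℝ) < 2 ^ a := by positivity
  -- The common point is halfway between the two centres; it is in `Y` because it lies below the
  -- upper one.
  have hle : ((k : ℝ) + 1 / 2) / 2 ^ a ≤ ((k + 1 : ℕ) : ℝ) / 2 ^ a := by
    gcongr
    push_cast
    linarith
  have hle1 := div_two_pow_le_one hk
  have h0 : 0 ≤ ((k : ℝ) + 1 / 2) / 2 ^ a := by positivity
  have hmem := hY.down h0 hle hle1 hxY
  refine ⟨_, ⟨?_, hmem⟩, ?_, hmem⟩
  · rw [pt_mem_cell h0 (hle.trans hle1), div_mul_cancel₀ _ h2.ne']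
    refine ⟨by linarith, by linarith, hs.imp_right ?_⟩
    rintro rfl
    exact hx
  · rw [pt_mem_cell h0 (hle.trans hle1), div_mul_cancel₀ _ h2.ne']
    push_cast
    exact ⟨by linarith, by linarith, Or.inr hx⟩

theorem overlap_iff (hY : IsStarlike Y) {s' : Fin b → Bool} (hk : Reach Y a s k)
    (hl : Reach Y a s' l) : (cell a s k ∩ Y ∩ (cell a s' l ∩ Y)).Nonempty ↔
      k ≤ l + 1 ∧ l ≤ k + 1 ∧ (k = 0 ∨ l = 0 ∨ s = s') := by
  constructor
  · rintro ⟨z, ⟨hz, -⟩, hz', -⟩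
    obtain ⟨t, x, h0, h1, rfl⟩ := exists_eq_pt z
    obtain ⟨h1, h2, h3⟩ := (pt_mem_cell h0 h1).1 hz
    obtain ⟨h1', h2', h3'⟩ := (pt_mem_cell h0 (by assumption)).1 hz'
    have e1 : (k : ℝ) < l + 2 := by linarith
    have e2 : (l : ℝ) < k + 2 := by linarith
    have e1' : k < l + 2 := by exact_mod_cast e1
    have e2' : l < k + 2 := by exact_mod_cast e2
    refine ⟨by omega, by omega, ?_⟩
    rcases h3 with h3 | h3
    · exact Or.inl h3
    rcases h3' with h3' | h3'
    · exact Or.inr (Or.inl h3')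
    · exact Or.inr (Or.inr (funext fun i => (h3 i).symm.trans (h3' i)))
  · rintro ⟨h1, h2, h3⟩
    rcases lt_trichotomy k l with h | rfl | h
    · obtain rfl : l = k + 1 := by omega
      exact hY.overlap_succ hl (by simpa using h3)
    · have : cell a s k ∩ Y = cell a s' k ∩ Y :=
        (cell_inter_eq_iff hk hl).2 ⟨rfl, by tauto⟩
      rw [← this, inter_self]
      obtain ⟨hk, x, hx, hxY⟩ := hk
      exact ⟨_, center_mem_cell hk hx, hxY⟩
    · obtain rfl : k = l + 1 := by omega
      rw [inter_comm]
      exact hY.overlap_succ hk (by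
        rcases h3 with h3 | h3 | h3
        · omega
        · exact Or.inl h3
        · exact Or.inr h3.symm)

/-- The restricted cells cover `Y`. -/
theorem exists_cell_mem (hY : IsStarlike Y) (a b : ℕ) (h0 : 0 ≤ t) (h1 : t ≤ 1)
    (hmem : pt t x ∈ Y) : ∃ (s : Fin b → Bool) (k : ℕ), Reach Y a s k ∧ pt t x ∈ cell a s k := by
  -- Rounding down keeps the centre in `Y`.
  refine ⟨fun i => x i, ⌊t * 2 ^ a⌋₊, hY.reach_of_mem h1 (fun _ => rfl) hmem ?_, ?_⟩
  · rw [div_le_iff₀ (by positivity)]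
    exact Nat.floor_le (by positivity)
  · rw [pt_mem_cell h0 h1]
    have := Nat.floor_le (a := t * 2 ^ a) (by positivity)
    exact ⟨by linarith, Nat.lt_floor_add_one _, Or.inr fun _ => rfl⟩

end IsStarlike

/-! ### Factoring inclusions through an intermediate level -/

/-- The choice `j = l / M` has its centre at or below that of `l`, so it is automatically available
in a starlike set. It fails only if `l` lies just above `k₀ * N * M` with `k = k₀ + 1`; then `j = k₀
* N + 1` is forced, and its centre is above that of `l`. -/
theorem subdivision_middle {N M : ℕ} (hN : 1 ≤ N) (hM : 1 ≤ M)
    (h1 : k * (N * M) < l + N * M) (h2 : l < k * (N * M) + N * M) :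
    (∃ j, j * M ≤ l ∧ (k * N < j + N ∧ j < k * N + N) ∧ (j * M < l + M ∧ l < j * M + M)) ∨
    ∃ k₀, k = k₀ + 1 ∧ k₀ * (N * M) < l ∧ l < (k₀ * N + 1) * M := by
  have hq := Nat.div_mul_le_self l M
  have hq' := Nat.lt_div_mul_add (a := l) (b := M) hM
  rcases lt_or_ge (k * N) (l / M + N) with h | h
  · refine Or.inl ⟨l / M, hq, ⟨h, ?_⟩, by omega, hq'⟩
    refine Nat.lt_of_mul_lt_mul_right (a := M) ?_
    calc l / M * M ≤ l := hq
      _ < (k * N + N) * M := by rw [add_mul, mul_assoc]; exact h2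
  · obtain _ | k₀ := k
    · rw [zero_mul] at h
      have := Nat.le_of_add_left_le h
      omega
    refine Or.inr ⟨k₀, rfl, by rw [Nat.succ_mul] at h1; omega, ?_⟩
    have : l / M ≤ k₀ * N := by rw [Nat.succ_mul] at h; omega
    have := Nat.mul_le_mul_right M this
    rw [add_mul, one_mul]
    omega

/-- `hcond` is used only in the exceptional case of `subdivision_middle`: the centre of the small
cell shows that `Y` rises above `k₀ / 2 ^ a`, and `hcond` then provides the next centre at the
middle scale. -/
theorem IsStarlike.exists_between (hY : IsStarlike Y) {a a' a'' b b' b'' c d : ℕ}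
    {s : Fin b → Bool} {s'' : Fin b'' → Bool} (hb : b ≤ b') (hb' : b' ≤ b'') (ha : a' = a + c)
    (ha' : a'' = a' + d)
    (hcond : ∀ (s' : Fin b' → Bool) (j : ℕ) (t : ℝ) (x : ℕ → Bool), t ≤ 1 →
      (∀ i : Fin b', x i = s' i) → (j : ℝ) / 2 ^ a < t → pt t x ∈ Y →
      Reach Y a' s' (j * 2 ^ c + 1))
    (hl : Reach Y a'' s'' l) (h : cell a'' s'' l ∩ Y ⊆ cell a s k ∩ Y) :
    ∃ (s' : Fin b' → Bool) (j : ℕ), Reach Y a' s' j ∧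
      cell a'' s'' l ∩ Y ⊆ cell a' s' j ∩ Y ∧ cell a' s' j ∩ Y ⊆ cell a s k ∩ Y := by
  have ha'' : a'' = a + (c + d) := by omega
  obtain ⟨h1, h2, h3⟩ := (cell_inter_subset_iff (hb.trans hb') ha'' hl).1 h
  rw [pow_add] at h2 h3
  rcases subdivision_middle Nat.one_le_two_pow Nat.one_le_two_pow h2 h3 with
    ⟨j, hj, hj1, hj2⟩ | ⟨k₀, rfl, hk1, hk2⟩
  · have hr := hY.reach_floor hb' ha' hl hj
    exact ⟨restr hb' s'', j, hr, (cell_inter_subset_iff hb' ha' hl).2 ⟨Or.inr rfl, hj2⟩,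
      (cell_inter_subset_iff hb ha hr).2 ⟨h1, hj1⟩⟩
  · have hr : Reach Y a' (restr hb' s'') (k₀ * 2 ^ c + 1) := by
      obtain ⟨hl1, x, hx, hxY⟩ := hl
      refine hcond _ k₀ _ x (div_two_pow_le_one hl1) (fun i => hx (Fin.castLE hb' i)) ?_ hxY
      have : (k₀ : ℝ) * (2 ^ c * 2 ^ d) < l := by exact_mod_cast hk1
      rw [ha'', pow_add, pow_add, div_lt_div_iff₀ (by positivity) (by positivity)]
      nlinarith [pow_pos (zero_lt_two (α := ℝ)) a]
    have hc : 1 ≤ 2 ^ c := Nat.one_le_two_pow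
    have hd : 1 ≤ 2 ^ d := Nat.one_le_two_pow
    refine ⟨_, _, hr, (cell_inter_subset_iff hb' ha' hl).2 ⟨Or.inr rfl, ?_, ?_⟩,
      (cell_inter_subset_iff hb ha hr).2 ⟨h1, ?_, ?_⟩⟩
    · rw [add_mul, one_mul, mul_assoc]; omega
    · omega
    · rw [add_mul]; omega
    · rw [add_mul]; omega

end FanSpec

namespace FanSpec

open CantorFan

/-! ### The graphs of restricted covers -/

/-- The overlap graph of a family of sets. -/
def overlapGraph {X : Type} (𝒞 : Set (Set X)) : SimpleGraph 𝒞 where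
  Adj g g' := g ≠ g' ∧ (g.1 ∩ g'.1).Nonempty
  symm := ⟨fun _ _ h => ⟨h.1.symm, by rw [inter_comm]; exact h.2⟩⟩
  loopless := ⟨fun _ h => h.1 rfl⟩

theorem edge_overlapGraph {X : Type} {𝒞 : Set (Set X)} (h𝒞 : ∀ g ∈ 𝒞, g.Nonempty) (g g' : 𝒞) :
    Edge (overlapGraph 𝒞) g g' ↔ (g.1 ∩ g'.1).Nonempty := by
  constructor
  · rintro (rfl | h)
    · rw [inter_self]; exact h𝒞 _ g.2
    · exact h.2
  · intro h
    by_cases hg : g = g'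
    · exact Or.inl hg
    · exact Or.inr ⟨hg, h⟩

theorem edgePreserving_overlapGraph {X : Type} {𝒞 𝒟 : Set (Set X)} (h𝒞 : ∀ g ∈ 𝒞, g.Nonempty)
    (h𝒟 : ∀ g ∈ 𝒟, g.Nonempty) :
    EdgePreserving (overlapGraph 𝒞) (overlapGraph 𝒟) fun g h => h.1 ⊆ g.1 := by
  intro h h' g g' hg hgg hg'
  rw [edge_overlapGraph h𝒟] at hgg
  rw [edge_overlapGraph h𝒞]
  exact hgg.mono (inter_subset_inter hg hg')

section

variable {Y : Set CantorFan} {a b c k l : ℕ} {t : ℝ} {x : ℕ → Bool}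

theorem finite_restrictedCover (a b : ℕ) (Y : Set CantorFan) : (restrictedCover a b Y).Finite := by
  refine (finite_range fun p : (Fin b → Bool) × Fin (2 ^ a + 1) => cell a p.1 p.2 ∩ Y).subset ?_
  intro h hh
  obtain ⟨s, k, hk, rfl⟩ := mem_restrictedCover.1 hh
  exact ⟨(s, ⟨k, Nat.lt_succ_of_le hk.1⟩), rfl⟩

theorem nonempty_of_mem_restrictedCover {g : Set CantorFan} (hg : g ∈ restrictedCover a b Y) :
    g.Nonempty := by
  obtain ⟨s, k, ⟨hk, x, hx, hxY⟩, rfl⟩ := mem_restrictedCover.1 hg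
  exact ⟨_, center_mem_cell hk hx, hxY⟩

namespace IsStarlike

/-- The member with centre at distance `min k (len Y a s)` from the root on the leg `s`. -/
noncomputable def vtx (hY : IsStarlike Y) (a b : ℕ) (s : Fin b → Bool) (k : ℕ) :
    restrictedCover a b Y :=
  ⟨cell a s (min k (len Y a s)) ∩ Y,
    mem_restrictedCover.2 ⟨s, _, hY.le_len_iff.1 (min_le_right _ _), rfl⟩⟩

theorem coe_vtx (hY : IsStarlike Y) {s : Fin b → Bool} (h : k ≤ len Y a s) :
    (hY.vtx a b s k : Set CantorFan) = cell a s k ∩ Y := by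
  simp [vtx, min_eq_left h]

theorem isSpider (hY : IsStarlike Y)
    (h3 : ∃ f : Fin 3 → (Fin b → Bool), Function.Injective f ∧ ∀ m, Reach Y a (f m) 1) :
    IsSpider (overlapGraph (restrictedCover a b Y)) (len Y a) (hY.vtx a b) := by
  have heq : ∀ {i j k l}, k ≤ len Y a i → l ≤ len Y a j →
      (hY.vtx a b i k = hY.vtx a b j l ↔ k = l ∧ (k = 0 ∨ i = j)) := by
    intro i j k l hk hl
    rw [Subtype.ext_iff, hY.coe_vtx hk, hY.coe_vtx hl]
    exact cell_inter_eq_iff (hY.le_len_iff.1 hk) (hY.le_len_iff.1 hl)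
  refine ⟨fun ⟨g, hg⟩ => ?_, heq, fun {i j k l} hk hl => ?_, ?_⟩
  · obtain ⟨s, k, hk, rfl⟩ := mem_restrictedCover.1 hg
    exact ⟨s, k, hY.le_len_iff.2 hk, Subtype.ext (hY.coe_vtx (hY.le_len_iff.2 hk))⟩
  · change (_ ≠ _ ∧ _) ↔ _
    rw [Ne, heq hk hl, hY.coe_vtx hk, hY.coe_vtx hl,
      hY.overlap_iff (hY.le_len_iff.1 hk) (hY.le_len_iff.1 hl)]
    by_cases hij : i = j
    · simp only [hij, or_true, and_true]; omega
    · simp only [hij, or_false]; omega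
  · obtain ⟨f, hf, h⟩ := h3
    exact ⟨f, hf, fun m => hY.le_len_iff.2 (h m)⟩

theorem subset_vtx_iff (hY : IsStarlike Y) {a' b' : ℕ} (hb : b ≤ b') (ha : a' = a + c)
    {s : Fin b → Bool} {s' : Fin b' → Bool} (hk : k ≤ len Y a s) (hl : l ≤ len Y a' s') :
    (hY.vtx a' b' s' l : Set CantorFan) ⊆ hY.vtx a b s k ↔
      (k = 0 ∨ s = restr hb s') ∧ k * 2 ^ c < l + 2 ^ c ∧ l < k * 2 ^ c + 2 ^ c := by
  rw [hY.coe_vtx hk, hY.coe_vtx hl]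
  exact cell_inter_subset_iff hb ha (hY.le_len_iff.1 hl)

theorem isMorL (hY : IsStarlike Y) {a' b' : ℕ} (hb : b ≤ b') (ha : a ≤ a')
    (h3 : ∃ f : Fin 3 → (Fin b → Bool), Function.Injective f ∧ ∀ m, Reach Y a (f m) 1)
    (h3' : ∃ f : Fin 3 → (Fin b' → Bool), Function.Injective f ∧ ∀ m, Reach Y a' (f m) 1) :
    IsMorL (overlapGraph (restrictedCover a b Y)) (overlapGraph (restrictedCover a' b' Y))
      fun g h => h.1 ⊆ g.1 := by
  obtain ⟨c, rfl⟩ := Nat.exists_eq_add_of_le ha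
  have := (finite_restrictedCover a b Y).to_subtype
  have := (finite_restrictedCover (a + c) b' Y).to_subtype
  refine (hY.isSpider h3).isMorL (hY.isSpider h3') (N := 2 ^ c) (π := restr hb)
    Nat.one_le_two_pow (edgePreserving_overlapGraph (fun _ => nonempty_of_mem_restrictedCover)
      fun _ => nonempty_of_mem_restrictedCover) (fun hk hl => hY.subset_vtx_iff hb rfl hk hl)
    (fun hl h => ?_) fun hk => ?_
  · rw [hY.le_len_iff] at hl ⊢
    exact hY.reach_floor hb rfl hl h
  · obtain ⟨hk, x, hx, hxY⟩ := hY.le_len_iff.1 hk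
    -- The lift follows a spoke on which the centre lies in `Y`; the lifted centre has the same
    -- height.
    refine ⟨fun i => x i, Or.inr (funext fun i => (hx i).symm), hY.le_len_iff.2 ?_⟩
    refine hY.reach_of_mem (div_two_pow_le_one hk) (fun _ => rfl) hxY (le_of_eq ?_)
    push_cast
    rw [pow_add]
    field_simp

end IsStarlike

theorem len_univ (s : Fin b → Bool) : IsStarlike.len univ a s = 2 ^ a := by
  refine eq_of_forall_le_iff fun k => ?_
  rw [isStarlike_univ.le_len_iff, reach_univ]

theorem isMorX_univ {a' b' : ℕ} (hb : b ≤ b') (ha : a ≤ a')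
    (h3 : ∃ f : Fin 3 → (Fin b → Bool), Function.Injective f ∧ ∀ m, Reach univ a (f m) 1)
    (h3' : ∃ f : Fin 3 → (Fin b' → Bool), Function.Injective f ∧ ∀ m, Reach univ a' (f m) 1) :
    IsMorX (overlapGraph (restrictedCover a b univ)) (overlapGraph (restrictedCover a' b' univ))
      fun g h => h.1 ⊆ g.1 := by
  refine ⟨isStarlike_univ.isMorL hb ha h3 h3', ?_⟩
  obtain ⟨c, rfl⟩ := Nat.exists_eq_add_of_le ha
  have := (finite_restrictedCover a b univ).to_subtype
  have := (finite_restrictedCover (a + c) b' univ).to_subtype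
  refine (isStarlike_univ.isSpider h3).endPreserving (isStarlike_univ.isSpider h3') (N := 2 ^ c)
    (π := restr hb) (fun hk hl => isStarlike_univ.subset_vtx_iff hb rfl hk hl) ?_ ?_ ?_
  · intro j
    rw [len_univ, len_univ, pow_add]
  · intro i j
    rw [len_univ, len_univ]
  · intro i
    rw [len_univ]
    positivity

/-! ### The sequence of restricted covers -/

/-- The conditions on the scales of product covers for their restrictions to `Y` to form a
sequence of graph fans. -/
structure IsAdmissible (Y : Set CantorFan) (α β : ℕ → ℕ) : Prop where
  star : IsStarlike Y
  strictMono_left : StrictMono α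
  strictMono_right : StrictMono β
  legs : ∀ n, ∃ f : Fin 3 → (Fin (β n) → Bool), Function.Injective f ∧
    ∀ m, Reach Y (α n) (f m) 1
  -- If `Y` rises above a centre of level `n` on a cylinder of level `n + 1`, it reaches the first
  -- finer centre above it there. This makes inclusions factor.
  gap : ∀ (n : ℕ) (s : Fin (β (n + 1)) → Bool) (j : ℕ) (t : ℝ) (x : ℕ → Bool), t ≤ 1 →
    (∀ i : Fin (β (n + 1)), x i = s i) → (j : ℝ) / 2 ^ α n < t → pt t x ∈ Y →
    Reach Y (α (n + 1)) s (j * 2 ^ (α (n + 1) - α n) + 1)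

theorem IsAdmissible.exists_between {α β : ℕ → ℕ} (h : IsAdmissible Y α β) {l m n : ℕ}
    (hlm : l ≤ m) (hmn : m ≤ n) {g g'' : Set CantorFan} (hg : g ∈ restrictedCover (α l) (β l) Y)
    (hg'' : g'' ∈ restrictedCover (α n) (β n) Y) (hsub : g'' ⊆ g) :
    ∃ g' ∈ restrictedCover (α m) (β m) Y, g' ⊆ g ∧ g'' ⊆ g' := by
  induction m, hlm using Nat.le_induction with
  | base => exact ⟨g, hg, Subset.rfl, hsub⟩
  | succ m hlm ih =>
    obtain ⟨g', hg', h1, h2⟩ := ih (by omega)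
    obtain ⟨s, k, -, rfl⟩ := mem_restrictedCover.1 hg'
    obtain ⟨s'', l, hl, rfl⟩ := mem_restrictedCover.1 hg''
    have hα := h.strictMono_left.monotone
    have hβ := h.strictMono_right.monotone
    have e1 := hα (Nat.le_succ m)
    have e2 := hα hmn
    obtain ⟨s', j, hj, h3, h4⟩ := h.star.exists_between (hβ (Nat.le_succ m)) (hβ hmn)
      (c := α (m + 1) - α m) (d := α n - α (m + 1)) (by simp only [Nat.succ_eq_add_one] at *; omega)
      (by omega) (h.gap m) hl h2
    exact ⟨_, mem_restrictedCover.2 ⟨s', j, hj, rfl⟩, h4.trans h1, h3⟩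

/-- With no subdivision (`c = 0`) the inclusion criterion forces equal positions. This yields the
identity law of the sequence. -/
theorem eq_of_subset_of_mem_restrictedCover {g g' : Set CantorFan}
    (hg : g ∈ restrictedCover a b Y) (hg' : g' ∈ restrictedCover a b Y) (h : g' ⊆ g) : g = g' := by
  obtain ⟨s, k, hk, rfl⟩ := mem_restrictedCover.1 hg
  obtain ⟨s', l, hl, rfl⟩ := mem_restrictedCover.1 hg'
  have := (cell_inter_subset_iff (c := 0) le_rfl rfl hl).1 h
  rw [pow_zero, mul_one] at this
  exact (cell_inter_eq_iff hk hl).2 ⟨by omega, this.1⟩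

/-- The sequence of the graphs of restricted covers with admissible scales. -/
def coverSeq {α β : ℕ → ℕ} (h : IsAdmissible Y α β) : GraphSeq where
  V n := restrictedCover (α n) (β n) Y
  finite n := (finite_restrictedCover _ _ _).to_subtype
  nonempty n := by
    obtain ⟨f, -, hf⟩ := h.legs n
    exact ⟨⟨_, mem_restrictedCover.2 ⟨f 0, 1, hf 0, rfl⟩⟩⟩
  graph n := overlapGraph _
  rel _ g g' := g'.1 ⊆ g.1
  edgePreserving _ := edgePreserving_overlapGraph (fun _ => nonempty_of_mem_restrictedCover)
    fun _ => nonempty_of_mem_restrictedCover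
  rel_self n g g' := ⟨fun hs => Subtype.ext (eq_of_subset_of_mem_restrictedCover g.2 g'.2 hs),
    fun hs => hs ▸ Subset.rfl⟩
  rel_comp hlm hmn g g'' := by
    constructor
    · intro hs
      obtain ⟨g', hg', h1, h2⟩ := h.exists_between hlm hmn g.2 g''.2 hs
      exact ⟨⟨g', hg'⟩, h1, h2⟩
    · rintro ⟨g', h1, h2⟩
      exact h2.trans h1

variable {α β : ℕ → ℕ}

theorem coverSeq_inL (h : IsAdmissible Y α β) : (coverSeq h).InL := by
  refine ⟨fun n => ?_, fun {m n} hmn => ?_⟩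
  · have := (finite_restrictedCover (α n) (β n) Y).to_subtype
    exact (h.star.isSpider (h.legs n)).isGraphFan
  · exact h.star.isMorL (h.strictMono_right.monotone hmn) (h.strictMono_left.monotone hmn)
      (h.legs m) (h.legs n)

theorem coverSeq_inX (h : IsAdmissible univ α β) : (coverSeq h).InX :=
  ⟨(coverSeq_inL h).1, fun {m n} hmn => isMorX_univ (h.strictMono_right.monotone hmn)
    (h.strictMono_left.monotone hmn) (h.legs m) (h.legs n)⟩

theorem coverSeq_isRealizedBy (h : IsAdmissible Y α β) :
    (coverSeq h).IsRealizedBy fun n => restrictedCover (α n) (β n) Y :=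
  ⟨fun _ => Subtype.val, fun _ => ⟨Subtype.val_injective, Subtype.range_val⟩,
    fun _ g g' => edge_overlapGraph (fun _ => nonempty_of_mem_restrictedCover) g g',
    fun _ _ _ => Iff.rfl⟩

/-! ### The spectrum of the sequence of restricted covers -/

theorem exists_one_lt_mul_two_pow {η : ℝ} (hη : 0 < η) : ∃ M : ℕ, ∀ a ≥ M, 1 < η * 2 ^ a := by
  obtain ⟨M, hM⟩ := pow_unbounded_of_one_lt (1 / η) (one_lt_two (α := ℝ))
  refine ⟨M, fun a ha => ?_⟩
  rw [div_lt_iff₀' hη] at hM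
  have : (2 : ℝ) ^ M ≤ 2 ^ a := pow_le_pow_right₀ one_le_two ha
  nlinarith

/-- The cells meeting a neighbourhood of a point are eventually small. -/
theorem exists_nhds_cell_subset {W : Set CantorFan} (hW : IsOpen W) {z : CantorFan} (hz : z ∈ W) :
    ∃ V, IsOpen V ∧ z ∈ V ∧ ∃ M : ℕ, ∀ a ≥ M, ∀ b ≥ M, ∀ (s : Fin b → Bool) (k : ℕ),
      (cell a s k ∩ V).Nonempty → cell a s k ⊆ W := by
  obtain ⟨t, y, h0, h1, rfl⟩ := exists_eq_pt z
  rcases h0.eq_or_lt with rfl | hpos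
  · obtain ⟨ε, hε, hεW⟩ := exists_height_subset hW hz
    -- Cells then have height extent `2 / 2 ^ a < ε / 2`, which added to the `ε / 2` of the
    -- neighbourhood stays below `ε`.
    obtain ⟨M, hM⟩ := exists_one_lt_mul_two_pow (η := ε / 4) (by positivity)
    have hV : ∀ x x' : ℕ → Bool, (0 : ℝ) < ε / 2 → (0 : ℝ) < ε / 2 := fun _ _ h => h
    refine ⟨sat fun t _ => t < ε / 2, isOpen_sat hV (isOpen_lt (by fun_prop) (by fun_prop)),
      (pt_mem_sat hV le_rfl h1).2 (by positivity), M, ?_⟩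
    rintro a ha b - s k ⟨z, hz, hzV⟩ w hw
    obtain ⟨t, x, h0, h1, rfl⟩ := exists_eq_pt z
    obtain ⟨t', x', h0', h1', rfl⟩ := exists_eq_pt w
    rw [pt_mem_sat hV h0 h1] at hzV
    obtain ⟨e1, -, -⟩ := (pt_mem_cell h0 h1).1 hz
    obtain ⟨-, e2, -⟩ := (pt_mem_cell h0' h1').1 hw
    have e3 := hM a ha
    refine hεW _ _ h0' h1' ?_
    refine lt_of_mul_lt_mul_right (a := (2 : ℝ) ^ a) ?_ (by positivity)
    have : t * 2 ^ a < ε / 2 * 2 ^ a := by gcongr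
    nlinarith
  · obtain ⟨ε, hε, n₀, hεW⟩ := exists_prod_subset hW h0 h1 hz
    -- The bound `ε / 4` controls the extent of cells; `t / 2` keeps the central cell, which ignores
    -- spokes, away from the neighbourhood.
    obtain ⟨M, hM⟩ := exists_one_lt_mul_two_pow (η := min (ε / 4) (t / 2)) (by positivity)
    have hV : ∀ x x' : ℕ → Bool,
        (|(0 : ℝ) - t| < ε / 2 ∧ t / 2 < 0 ∧ ∀ i : Fin n₀, x i = y i) →
        (|(0 : ℝ) - t| < ε / 2 ∧ t / 2 < 0 ∧ ∀ i : Fin n₀, x' i = y i) := fun _ _ h => by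
      linarith [h.2.1]
    have o1 : IsOpen {p : ℝ × (ℕ → Bool) | |p.1 - t| < ε / 2} :=
      isOpen_lt (by fun_prop) (by fun_prop)
    have o2 : IsOpen {p : ℝ × (ℕ → Bool) | t / 2 < p.1} := isOpen_lt (by fun_prop) (by fun_prop)
    refine ⟨sat fun t' x => |t' - t| < ε / 2 ∧ t / 2 < t' ∧ ∀ i : Fin n₀, x i = y i,
      isOpen_sat hV (o1.inter (o2.inter (isOpen_cylinder fun i : Fin n₀ => y i))),
      (pt_mem_sat hV h0 h1).2 ⟨by simpa using hε, by linarith, fun _ => rfl⟩, max M n₀, ?_⟩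
    rintro a ha b hb s k ⟨z, hz, hzV⟩ w hw
    obtain ⟨t', x, h0', h1', rfl⟩ := exists_eq_pt z
    obtain ⟨t'', x', h0'', h1'', rfl⟩ := exists_eq_pt w
    obtain ⟨v1, v2, v3⟩ := (pt_mem_sat hV h0' h1').1 hzV
    obtain ⟨e1, e2, e3⟩ := (pt_mem_cell h0' h1').1 hz
    obtain ⟨f1, f2, f3⟩ := (pt_mem_cell h0'' h1'').1 hw
    have hpow : (0 : ℝ) < 2 ^ a := by positivity
    have hM1 := hM a (le_trans (le_max_left _ _) ha)
    have hM2 : 1 < ε / 4 * 2 ^ a := hM1.trans_le (by gcongr; exact min_le_left _ _)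
    have hM3 : 1 < t / 2 * 2 ^ a := hM1.trans_le (by gcongr; exact min_le_right _ _)
    have hk : k ≠ 0 := by
      rintro rfl
      have : t / 2 * 2 ^ a < t' * 2 ^ a := by gcongr
      rw [Nat.cast_zero, zero_add] at e2
      linarith
    refine hεW _ _ h0'' h1'' ?_ fun i => ?_
    · have : |t'' - t'| < ε / 2 := by
        rw [abs_lt]
        constructor
        · refine lt_of_mul_lt_mul_right (a := (2 : ℝ) ^ a) ?_ hpow.le
          nlinarith
        · refine lt_of_mul_lt_mul_right (a := (2 : ℝ) ^ a) ?_ hpow.le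
          nlinarith
      calc |t'' - t| ≤ |t'' - t'| + |t' - t| := abs_sub_le _ _ _
        _ < ε := by linarith
    · have hi : (i : ℕ) < b := i.2.trans_le (le_trans (le_max_right _ _) hb)
      have g1 := (e3.resolve_left hk) ⟨i, hi⟩
      have g2 := (f3.resolve_left hk) ⟨i, hi⟩
      exact g2.trans (g1.symm.trans (v3 i))

/-- The set of points represented by a vertex. -/
def vertexSet (h : IsAdmissible Y α β) {n : ℕ} (g : (coverSeq h).V n) : Set CantorFan :=
  Subtype.val (p := (· ∈ restrictedCover (α n) (β n) Y)) g

theorem vertexSet_mem (h : IsAdmissible Y α β) {n : ℕ} (g : (coverSeq h).V n) :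
    vertexSet h g ∈ restrictedCover (α n) (β n) Y :=
  Subtype.property (p := (· ∈ restrictedCover (α n) (β n) Y)) g

/-- A vertex of the `n`-th graph as an element of the induced poset. -/
def toPoset (S : GraphSeq) (n : ℕ) (g : S.V n) : S.Poset := ⟨n, g⟩

theorem le_iff_coverSeq (h : IsAdmissible Y α β) {p q : (coverSeq h).Poset} :
    p ≤ q ↔ q.1 ≤ p.1 ∧ vertexSet h p.2 ⊆ vertexSet h q.2 :=
  ⟨fun ⟨h, h'⟩ => ⟨h, h'⟩, fun ⟨h, h'⟩ => ⟨h, h'⟩⟩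

theorem exists_mem_level (h : IsAdmissible Y α β) (n : ℕ) {y : CantorFan} (hy : y ∈ Y) :
    ∃ g : (coverSeq h).V n, y ∈ vertexSet h g := by
  obtain ⟨t, x, h0, h1, rfl⟩ := exists_eq_pt y
  obtain ⟨s, k, hk, hmem⟩ := h.star.exists_cell_mem (α n) (β n) h0 h1 hy
  exact ⟨⟨_, mem_restrictedCover.2 ⟨s, k, hk, rfl⟩⟩, hmem, hy⟩

/-- Co-injectivity puts a member of the level below each coarser vertex, co-surjectivity one above
each finer vertex. -/
theorem isBand_level (h : IsAdmissible Y α β) (n : ℕ) :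
    IsBand (range (toPoset (coverSeq h) n)) := by
  have := (coverSeq h).finite n
  refine ⟨finite_range _, fun p => ?_⟩
  obtain ⟨m, g⟩ := p
  rcases le_total m n with hmn | hmn
  · obtain ⟨g', hg'⟩ := ((coverSeq_inL h).2 hmn).2.1 g
    exact ⟨_, ⟨g', rfl⟩, Or.inl ⟨hmn, (hg' g).2 rfl⟩⟩
  · obtain ⟨g', hg'⟩ := ((coverSeq_inL h).2 hmn).2.2.1 g
    exact ⟨_, ⟨g', rfl⟩, Or.inr ⟨hmn, hg'⟩⟩

theorem isCap_iff_cover (h : IsAdmissible Y α β) (C : Set (coverSeq h).Poset) :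
    IsCap C ↔ ∀ y ∈ Y, ∃ p ∈ C, y ∈ vertexSet h p.2 := by
  constructor
  · rintro ⟨B, ⟨hB, hB'⟩, hBC⟩ y hy
    obtain ⟨N, hN⟩ := (hB.image Sigma.fst).bddAbove
    -- This level is deeper than the whole band, so a band member comparable to `g` must lie above
    -- it.
    obtain ⟨g, hg⟩ := exists_mem_level h (N + 1) hy
    obtain ⟨b, hb, hbg | hgb⟩ := hB' (toPoset (coverSeq h) (N + 1) g)
    · have h1 : N + 1 ≤ b.1 := hbg.1
      have h2 : b.1 ≤ N := hN ⟨b, hb, rfl⟩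
      omega
    · obtain ⟨c, hc, hbc⟩ := hBC b hb
      exact ⟨c, hc, ((le_iff_coverSeq h).1 (hgb.trans hbc)).2 hg⟩
  · intro hC
    have : Nonempty (coverSeq h).Poset := ((coverSeq h).nonempty 0).map (toPoset _ 0)
    choose! p hpC hp using hC
    have hloc : ∀ y ∈ Y, ∃ V, IsOpen V ∧ y ∈ V ∧ ∃ M : ℕ, ∀ a ≥ M, ∀ b ≥ M,
        ∀ (s : Fin b → Bool) (k : ℕ), (cell a s k ∩ V).Nonempty →
          cell a s k ∩ Y ⊆ vertexSet h (p y).2 := by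
      intro y hy
      obtain ⟨s, k, -, hsk⟩ := mem_restrictedCover.1 (vertexSet_mem h (p y).2)
      have hy' : y ∈ cell (α (p y).1) s k := by
        have := hp y hy
        rw [hsk] at this
        exact this.1
      obtain ⟨V, hV, hyV, M, hM⟩ := exists_nhds_cell_subset (isOpen_cell _ s k) hy'
      refine ⟨V, hV, hyV, M, fun a ha b hb s' k' hne => ?_⟩
      rw [hsk]
      exact inter_subset_inter_left _ (hM a ha b hb s' k' hne)
    choose! V hV hyV M hM using hloc
    obtain ⟨F, hFY, hF⟩ := h.star.closed.isCompact.elim_nhds_subcover V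
      fun y hy => (hV y hy).mem_nhds (hyV y hy)
    -- At this level every cell has its centre in one of finitely many `V y`, is small enough to fit
    -- in the set chosen for `y`, and is at least as deep as that set's vertex.
    refine ⟨_, isBand_level h (F.sup fun y => max (M y) (p y).1), ?_⟩
    rintro _ ⟨⟨g, hg⟩, rfl⟩
    obtain ⟨s, k, ⟨hk, x, hx, hxY⟩, rfl⟩ := mem_restrictedCover.1 hg
    obtain ⟨y, hyF, hyx⟩ := mem_iUnion₂.1 (hF hxY)
    have hle := Finset.le_sup (f := fun y => max (M y) (p y).1) hyF
    have hyY := hFY y hyF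
    refine ⟨p y, hpC y hyY, (le_iff_coverSeq h).2 ⟨(le_max_right _ _).trans hle, ?_⟩⟩
    exact hM y hyY _ (((le_max_left _ _).trans hle).trans (h.strictMono_left.le_apply)) _
      (((le_max_left _ _).trans hle).trans (h.strictMono_right.le_apply)) s k
      ⟨_, center_mem_cell hk hx, hyx⟩

theorem coverSeq_spectrum (h : IsAdmissible Y α β) : Nonempty ((coverSeq h).Spec ≃ₜ Y) := by
  refine spectrum_homeomorph (fun p => Subtype.val ⁻¹' vertexSet h p.2) (fun p => ?_)
    (fun y W hW hy => ?_) fun C => ?_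
  · obtain ⟨s, k, -, hsk⟩ := mem_restrictedCover.1 (vertexSet_mem h p.2)
    rw [hsk]
    convert (isOpen_cell _ s k).preimage (continuous_subtype_val (p := (· ∈ Y))) using 1
    ext z
    exact and_iff_left z.2
  · obtain ⟨W, hW', rfl⟩ := isOpen_induced_iff.1 hW
    obtain ⟨V, -, hyV, M, hM⟩ := exists_nhds_cell_subset hW' (show y.1 ∈ W from hy)
    obtain ⟨⟨g, hg⟩, hyg⟩ := exists_mem_level h M y.2
    refine ⟨⟨M, g, hg⟩, hyg, fun z hz => ?_⟩
    obtain ⟨s, k, -, rfl⟩ := mem_restrictedCover.1 hg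
    exact hM _ h.strictMono_left.le_apply _ h.strictMono_right.le_apply s k
      ⟨_, hyg.1, hyV⟩ hz.1
  · rw [isCap_iff_cover h, Subtype.forall]
    rfl

end

end FanSpec

namespace FanSpec

open CantorFan

/-! ### Subfans of the Cantor fan -/

/-- A connected closed set containing a point of the spoke `y` and a point that is not on this
spoke above height `u` contains the intermediate points of the spoke `y`. -/
theorem pt_mem_of_isPreconnected {C : Set CantorFan} (hC : IsClosed C) (hconn : IsPreconnected C)
    {t u : ℝ} {y : ℕ → Bool} (hu : 0 ≤ u) (hut : u < t) (ht : t ≤ 1) (hyC : pt t y ∈ C)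
    {z : CantorFan} (hzC : z ∈ C) (hz : ∀ t', u < t' → t' ≤ 1 → z ≠ pt t' y) :
    pt u y ∈ C := by
  by_contra hcon
  have hu1 : u ≤ 1 := hut.le.trans ht
  obtain ⟨ε, hε, n₀, hn₀⟩ := exists_prod_subset hC.isOpen_compl hu hu1 hcon
  obtain ⟨r, x, hr0, hr1, rfl⟩ := exists_eq_pt z
  -- The cylinder of length `n` is cut at height `u`, where it misses `C`; it is narrow enough to
  -- leave `z` outside its upper part.
  obtain ⟨n, hn, hrx⟩ : ∃ n ≥ n₀, r ≤ u ∨ ∃ i : Fin n, x i ≠ y i := by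
    rcases le_or_gt r u with h | h
    · exact ⟨n₀, le_rfl, Or.inl h⟩
    · have hxy : x ≠ y := fun hxy => hz r h hr1 (by rw [hxy])
      obtain ⟨i, hi⟩ := Function.ne_iff.1 hxy
      exact ⟨max n₀ (i + 1), le_max_left _ _, Or.inr ⟨⟨i, by simp⟩, hi⟩⟩
  have hcut : ∀ x : ℕ → Bool, (∀ i : Fin n, x i = y i) → pt u x ∉ C := fun x hx =>
    hn₀ u x hu hu1 (by simpa using hε) fun i => hx (Fin.castLE hn i)
  let Q₁ : ℝ → (ℕ → Bool) → Prop := fun t x => u < t ∧ ∀ i : Fin n, x i = y i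
  -- The clause `0 < t` makes the condition independent of the spoke at the root. When `u = 0` the
  -- root is left out of both sets, but then it is not in `C`.
  let Q₂ : ℝ → (ℕ → Bool) → Prop := fun t x => t < u ∨ (0 < t ∧ ¬ ∀ i : Fin n, x i = y i)
  have hQ₁ : ∀ x x', Q₁ 0 x → Q₁ 0 x' := fun x x' h => absurd h.1 hu.not_gt
  have hQ₂ : ∀ x x', Q₂ 0 x → Q₂ 0 x' := fun x x' h => by
    rcases h with h | h
    · exact Or.inl h
    · exact absurd h.1 (lt_irrefl 0)
  have hcyl := isOpen_cylinder fun i : Fin n => y i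
  have hcyl' : IsOpen {p : ℝ × (ℕ → Bool) | ¬ ∀ i : Fin n, p.2 i = y i} := by
    have : IsClosed {p : ℝ × (ℕ → Bool) | ∀ i : Fin n, p.2 i = y i} := by
      simp only [ofPred_forall]
      exact isClosed_iInter fun i => (isClosed_discrete {y i}).preimage
        (f := fun p : ℝ × (ℕ → Bool) => p.2 i) (by fun_prop)
    exact this.isOpen_compl
  have o1 : IsOpen {p : ℝ × (ℕ → Bool) | u < p.1} := isOpen_lt (by fun_prop) (by fun_prop)
  have o2 : IsOpen {p : ℝ × (ℕ → Bool) | p.1 < u} := isOpen_lt (by fun_prop) (by fun_prop)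
  have o3 : IsOpen {p : ℝ × (ℕ → Bool) | 0 < p.1} := isOpen_lt (by fun_prop) (by fun_prop)
  have hO₁ : IsOpen (sat Q₁) := isOpen_sat hQ₁ (o1.inter hcyl)
  have hO₂ : IsOpen (sat Q₂) := isOpen_sat hQ₂ (o2.union (o3.inter hcyl'))
  have hcov : C ⊆ sat Q₁ ∪ sat Q₂ := by
    intro w hw
    obtain ⟨t', x', h0, h1, rfl⟩ := exists_eq_pt w
    rw [mem_union, pt_mem_sat hQ₁ h0 h1, pt_mem_sat hQ₂ h0 h1]
    by_cases hx' : ∀ i : Fin n, x' i = y i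
    · rcases lt_trichotomy t' u with h | rfl | h
      · exact Or.inr (Or.inl h)
      · exact absurd hw (hcut x' hx')
      · exact Or.inl ⟨h, hx'⟩
    · rcases h0.eq_or_lt with rfl | h
      · rcases hu.eq_or_lt with rfl | h
        · rw [pt_zero x' y] at hw
          exact absurd hw hcon
        · exact Or.inr (Or.inl h)
      · exact Or.inr (Or.inr ⟨h, hx'⟩)
  have hne₁ : (C ∩ sat Q₁).Nonempty :=
    ⟨_, hyC, (pt_mem_sat hQ₁ (hu.trans hut.le) ht).2 ⟨hut, fun _ => rfl⟩⟩
  have hne₂ : (C ∩ sat Q₂).Nonempty := by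
    have hzC' := hcov hzC
    refine ⟨_, hzC, hzC'.resolve_left fun h => ?_⟩
    obtain ⟨h1, h2⟩ := (pt_mem_sat hQ₁ hr0 hr1).1 h
    rcases hrx with h | ⟨i, hi⟩
    · exact absurd h1 h.not_gt
    · exact hi (h2 i)
  obtain ⟨w, -, hw₁, hw₂⟩ := hconn _ _ hO₁ hO₂ hcov hne₁ hne₂
  obtain ⟨t', x', h0, h1, rfl⟩ := exists_eq_pt w
  obtain ⟨h1', h2'⟩ := (pt_mem_sat hQ₁ h0 h1).1 hw₁
  rcases (pt_mem_sat hQ₂ h0 h1).1 hw₂ with h | ⟨-, h⟩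
  · exact absurd h h1'.not_gt
  · exact h h2'

theorem isStarlike_of_isPreconnected {Y : Set CantorFan} (hY : IsClosed Y)
    (hconn : IsPreconnected Y) (hroot : ∀ x, pt 0 x ∈ Y) : IsStarlike Y := by
  refine ⟨hY, hroot, fun {t t' x} h0 htt h1 hmem => ?_⟩
  rcases htt.eq_or_lt with rfl | hlt
  · exact hmem
  · refine pt_mem_of_isPreconnected hY hconn h0 hlt h1 hmem (hroot x) fun r hr hr1 h => ?_
    have := ((pt_eq_pt le_rfl zero_le_one (h0.trans hr.le) hr1).1 h).1
    linarith

/-- The image of an arc of a subspace of the Cantor fan. -/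
theorem IsArc.image_val {Y : Set CantorFan} {A : Set Y} (hA : IsArc A) :
    IsClosed (Subtype.val '' A) ∧ IsPreconnected (Subtype.val '' A) ∧ A.Nontrivial := by
  obtain ⟨e⟩ := hA
  have hcomp : CompactSpace A := e.symm.compactSpace
  have hconn : PreconnectedSpace A := by
    have := e.symm.surjective.denseRange.preconnectedSpace e.symm.continuous
    exact this
  refine ⟨((isCompact_iff_compactSpace.2 hcomp).image continuous_subtype_val).isClosed,
    (isPreconnected_iff_preconnectedSpace.2 hconn).image _ continuous_subtype_val.continuousOn, ?_⟩
  exact ⟨e.symm 0, (e.symm 0).2, e.symm 1, (e.symm 1).2, fun h =>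
    zero_ne_one (e.symm.injective (Subtype.ext h))⟩

/-- A connected closed nontrivial set contains a segment on one of the two sides of each of its
points other than the root. -/
theorem exists_segment {C : Set CantorFan} (hC : IsClosed C) (hconn : IsPreconnected C)
    {t : ℝ} {y : ℕ → Bool} (h0 : 0 < t) (h1 : t ≤ 1) (hmem : pt t y ∈ C) {z : CantorFan}
    (hz : z ∈ C) (hne : z ≠ pt t y) :
    (∃ e < t, 0 ≤ e ∧ ∀ u, e < u → u < t → pt u y ∈ C) ∨
      ∃ e > t, e ≤ 1 ∧ ∀ u, t < u → u < e → pt u y ∈ C := by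
  by_cases hup : ∃ t', t < t' ∧ t' ≤ 1 ∧ z = pt t' y
  · obtain ⟨t', ht', ht1, rfl⟩ := hup
    refine Or.inr ⟨t', ht', ht1, fun u hu hu' => ?_⟩
    refine pt_mem_of_isPreconnected hC hconn (h0.trans hu).le hu' ht1 hz hmem
      fun r hr hr1 h => ?_
    have := ((pt_eq_pt h0.le h1 (h0.trans (hu.trans hr)).le hr1).1 h).1
    linarith
  · left
    push Not at hup
    by_cases hdown : ∃ t', 0 ≤ t' ∧ t' < t ∧ z = pt t' y
    · obtain ⟨t', ht0, ht', rfl⟩ := hdown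
      refine ⟨t', ht', ht0, fun u hu hu' => ?_⟩
      refine pt_mem_of_isPreconnected hC hconn (ht0.trans hu.le) hu' h1 hmem hz
        fun r hr hr1 h => ?_
      have := ((pt_eq_pt ht0 (ht'.le.trans h1) (ht0.trans (hu.trans hr).le) hr1).1 h).1
      linarith
    · push Not at hdown
      refine ⟨0, h0, le_rfl, fun u hu hu' => ?_⟩
      refine pt_mem_of_isPreconnected hC hconn hu.le hu' h1 hmem hz fun r hr hr1 h => ?_
      rcases lt_trichotomy r t with hrt | rfl | hrt
      · exact hdown r (hu.trans hr).le hrt h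
      · exact hne h
      · exact hup r hrt hr1 h

theorem exists_ne_eq_of_bool (f : Fin 3 → Prop) : ∃ i j, i ≠ j ∧ (f i ↔ f j) := by
  by_cases h0 : f 0 <;> by_cases h1 : f 1 <;> by_cases h2 : f 2
  all_goals first
    | exact ⟨0, 1, by decide, by tauto⟩
    | exact ⟨0, 2, by decide, by tauto⟩
    | exact ⟨1, 2, by decide, by tauto⟩

/-- The structure of subfans of the Cantor fan. -/
theorem IsTopFan.isStarlike {Y : Set CantorFan} (hY : IsTopFan Y) :
    IsStarlike Y ∧ ∃ (y : Fin 3 → ℕ → Bool) (t : Fin 3 → ℝ), Function.Injective y ∧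
      ∀ i, 0 < t i ∧ t i ≤ 1 ∧ pt (t i) (y i) ∈ Y := by
  obtain ⟨⟨⟨hcomp, hconn, -⟩, -, -⟩, p, ⟨A, hA, hAA⟩, -⟩ := hY
  have hclosed : IsClosed Y := (isCompact_iff_compactSpace.2 hcomp).isClosed
  have hpre : IsPreconnected Y := isPreconnected_iff_preconnectedSpace.2 inferInstance
  have hpA : ∀ i, p ∈ A i := fun i => by
    obtain ⟨j, hj⟩ := exists_ne i
    have : p ∈ A i ∩ A j := by rw [hAA i j hj.symm]; rfl
    exact this.1
  have hex : ∀ i, ∃ z ∈ A i, z ≠ p := fun i => (hA i).image_val.2.2.exists_ne p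
  choose z hzA hzp using hex
  have hinter : ∀ i j w, i ≠ j → w ∈ Subtype.val '' A i → w ∈ Subtype.val '' A j →
      w = (p : CantorFan) := by
    rintro i j _ hij ⟨w, hw, rfl⟩ ⟨w', hw', h⟩
    obtain rfl := Subtype.ext h
    have : w' ∈ A i ∩ A j := ⟨hw, hw'⟩
    rw [hAA i j hij] at this
    exact congrArg _ this
  have hpA' : ∀ i, (p : CantorFan) ∈ Subtype.val '' A i := fun i => ⟨p, hpA i, rfl⟩
  have hzA' : ∀ i, (z i : CantorFan) ∈ Subtype.val '' A i := fun i => ⟨z i, hzA i, rfl⟩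
  have hzp' : ∀ i, (z i : CantorFan) ≠ p := fun i h => hzp i (Subtype.ext h)
  obtain ⟨t, y, h0, h1, hp⟩ := exists_eq_pt (p : CantorFan)
  have hsubY : ∀ i, Subtype.val '' A i ⊆ Y := fun i => by
    rintro _ ⟨w, -, rfl⟩
    exact w.2
  rw [hp] at hpA' hzp' hinter
  -- Away from the root each arc contains a segment on one of two sides, so two of the three arcs
  -- share a side and meet in more than `p`.
  obtain rfl : t = 0 := by
    by_contra hne
    have hpos : 0 < t := h0.lt_of_ne' hne
    have hseg := fun i => exists_segment (hA i).image_val.1 (hA i).image_val.2.1 hpos h1 (hpA' i)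
      (hzA' i) (hzp' i)
    obtain ⟨i, j, hij, hiff⟩ := exists_ne_eq_of_bool fun i =>
      ∃ e < t, 0 ≤ e ∧ ∀ u, e < u → u < t → pt u y ∈ Subtype.val '' A i
    by_cases hi : ∃ e < t, 0 ≤ e ∧ ∀ u, e < u → u < t → pt u y ∈ Subtype.val '' A i
    · obtain ⟨e', he', he0', hs'⟩ := hiff.1 hi
      obtain ⟨e, he, he0, hs⟩ := hi
      obtain ⟨u, hu, hu'⟩ := exists_between (max_lt he he')
      have := hinter i j _ hij (hs u ((le_max_left _ _).trans_lt hu) hu')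
        (hs' u ((le_max_right _ _).trans_lt hu) hu')
      rw [pt_eq_pt (he0.trans ((le_max_left _ _).trans hu.le)) (hu'.le.trans h1) h0 h1] at this
      linarith [this.1]
    · obtain ⟨e, he, he1, hs⟩ := (hseg i).resolve_left hi
      obtain ⟨e', he', he1', hs'⟩ := (hseg j).resolve_left fun h => hi (hiff.2 h)
      obtain ⟨u, hu, hu'⟩ := exists_between (lt_min he he')
      have := hinter i j _ hij (hs u hu (hu'.trans_le (min_le_left _ _)))
        (hs' u hu (hu'.trans_le (min_le_right _ _)))
      rw [pt_eq_pt (h0.trans hu.le) ((hu'.le.trans (min_le_left _ _)).trans he1) h0 h1] at this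
      linarith [this.1]
  have hroot : ∀ i x, pt 0 x ∈ Subtype.val '' A i := fun i x => by
    rw [pt_zero x y]; exact hpA' i
  refine ⟨isStarlike_of_isPreconnected hclosed hpre fun x => hsubY 0 (hroot 0 x), ?_⟩
  choose r x hr0 hr1 hz using fun i => exists_eq_pt (z i : CantorFan)
  have hrpos : ∀ i, 0 < r i := fun i => by
    refine (hr0 i).lt_of_ne fun h => hzp' i ?_
    rw [hz i, ← h]
    exact pt_zero _ _
  refine ⟨x, r, fun i j hij => ?_, fun i => ⟨hrpos i, hr1 i, hz i ▸ (z i).2⟩⟩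
  -- Two arcs ending on one spoke would both contain its segment from the root up to the lower of
  -- the two heights.
  by_contra hne
  have hstar := fun i =>
    isStarlike_of_isPreconnected (hA i).image_val.1 (hA i).image_val.2.1 (hroot i)
  have hm : 0 < min (r i) (r j) := lt_min (hrpos i) (hrpos j)
  have hmi := (hstar i).down hm.le (min_le_left _ _) (hr1 i) (hz i ▸ hzA' i)
  have hmj := (hstar j).down hm.le (min_le_right _ _) (hr1 j) (hz j ▸ hzA' j)
  rw [← hij] at hmj
  have := hinter i j _ hne hmi hmj
  rw [pt_eq_pt hm.le ((min_le_left _ _).trans (hr1 i)) h0 h1] at this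
  linarith [this.1]

/-! ### Existence of admissible scales -/

theorem restr_injective_of_large (y : Fin 3 → ℕ → Bool) (hy : Function.Injective y) :
    ∃ n₀ : ℕ, ∀ n ≥ n₀, Function.Injective fun (m : Fin 3) (i : Fin n) => y m i := by
  have hex : ∀ i j, ∃ k, i ≠ j → y i k ≠ y j k := fun i j => by
    by_cases hij : i = j
    · exact ⟨0, fun h => absurd hij h⟩
    · obtain ⟨k, hk⟩ := Function.ne_iff.1 (hy.ne hij)
      exact ⟨k, fun _ => hk⟩
  choose k hk using hex
  refine ⟨Finset.univ.sup (fun p : Fin 3 × Fin 3 => k p.1 p.2) + 1, fun n hn i j hij => ?_⟩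
  by_contra hne
  have hlt : k i j < n := lt_of_lt_of_le (Nat.lt_succ_of_le
    (Finset.le_sup (f := fun p : Fin 3 × Fin 3 => k p.1 p.2) (Finset.mem_univ (i, j)))) hn
  exact hk i j hne (congrFun hij ⟨k i j, hlt⟩)

theorem IsStarlike.exists_legs {Y : Set CantorFan} (hY : IsStarlike Y) {y : Fin 3 → ℕ → Bool}
    {t : Fin 3 → ℝ} (hy : Function.Injective y)
    (h : ∀ i, 0 < t i ∧ t i ≤ 1 ∧ pt (t i) (y i) ∈ Y) :
    ∃ n₀ : ℕ, ∀ a ≥ n₀, ∀ b ≥ n₀, ∃ f : Fin 3 → (Fin b → Bool), Function.Injective f ∧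
      ∀ m, Reach Y a (f m) 1 := by
  obtain ⟨n₁, hn₁⟩ := restr_injective_of_large y hy
  choose M hM using fun i => exists_one_lt_mul_two_pow (h i).1
  refine ⟨max n₁ (Finset.univ.sup M), fun a ha b hb =>
    ⟨fun m i => y m i, hn₁ b ((le_max_left _ _).trans hb), fun m => ?_⟩⟩
  refine hY.reach_of_mem (h m).2.1 (fun _ => rfl) (h m).2.2 ?_
  have := hM m a ((Finset.le_sup (f := M) (Finset.mem_univ m)).trans ((le_max_right _ _).trans ha))
  rw [Nat.cast_one, div_le_iff₀ (by positivity)]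
  exact this.le

theorem isAdmissible_univ {α β : ℕ → ℕ} (hα : StrictMono α) (hβ : StrictMono β) :
    ∃ n₀ : ℕ, IsAdmissible univ (fun n => α (n₀ + n)) fun n => β (n₀ + n) := by
  let y : Fin 3 → ℕ → Bool := fun m i => decide (i = m)
  have hy : Function.Injective y := fun m m' h => by
    have := congrFun h m
    simp only [y, decide_true] at this
    exact Fin.ext (of_decide_eq_true this.symm)
  obtain ⟨n₀, hn₀⟩ := isStarlike_univ.exists_legs (t := fun _ => 1) hy
    fun _ => ⟨one_pos, le_rfl, mem_univ _⟩
  have hadd : StrictMono fun n => n₀ + n := fun _ _ h => Nat.add_lt_add_left h n₀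
  refine ⟨n₀, isStarlike_univ, hα.comp hadd, hβ.comp hadd, fun n => hn₀ _ ?_ _ ?_, ?_⟩
  · exact (Nat.le_add_right n₀ n).trans hα.le_apply
  · exact (Nat.le_add_right n₀ n).trans hβ.le_apply
  -- Only `j < 2 ^ α (n₀ + n)` matters, and then the next finer centre is still at height at most
  -- `1`.
  · intro n s j t x ht _ hj _
    have hlt : α (n₀ + n) < α (n₀ + (n + 1)) := hα (by omega)
    obtain ⟨c, hc⟩ := Nat.exists_eq_add_of_le hlt.le
    have hj1 := hj.trans_le ht
    rw [div_lt_one (by positivity)] at hj1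
    have hj2 : j + 1 ≤ 2 ^ α (n₀ + n) := by exact_mod_cast hj1
    rw [reach_univ]
    rw [hc, Nat.add_sub_cancel_left, pow_add]
    have h1 := Nat.mul_le_mul_right (2 ^ c) hj2
    have h2 : 1 ≤ 2 ^ c := Nat.one_le_two_pow
    rw [add_mul] at h1
    omega

/-- Only finitely many pairs `(s, j)` with `j < 2 ^ a` are relevant. For each one where `Y` rises
above `j / 2 ^ a`, a single fixed point of `Y` above that height decides how fine the scale has to
be. -/
theorem IsStarlike.exists_gap {Y : Set CantorFan} (hY : IsStarlike Y) (a b : ℕ) :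
    ∃ a' > a, ∀ (s : Fin b → Bool) (j : ℕ) (t : ℝ) (x : ℕ → Bool), t ≤ 1 →
      (∀ i : Fin b, x i = s i) → (j : ℝ) / 2 ^ a < t → pt t x ∈ Y →
      Reach Y a' s (j * 2 ^ (a' - a) + 1) := by
  have hex : ∀ p : (Fin b → Bool) × Fin (2 ^ a), ∃ M : ℕ, ∀ a' ≥ M,
      ∀ (t : ℝ) (x : ℕ → Bool), t ≤ 1 → (∀ i : Fin b, x i = p.1 i) →
        ((p.2 : ℕ) : ℝ) / 2 ^ a < t → pt t x ∈ Y →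
        ∃ (t : ℝ) (x : ℕ → Bool), t ≤ 1 ∧ (∀ i : Fin b, x i = p.1 i) ∧ pt t x ∈ Y ∧
          1 < (t - ((p.2 : ℕ) : ℝ) / 2 ^ a) * 2 ^ a' := by
    intro p
    by_cases hp : ∃ (t : ℝ) (x : ℕ → Bool), t ≤ 1 ∧ (∀ i : Fin b, x i = p.1 i) ∧
        ((p.2 : ℕ) : ℝ) / 2 ^ a < t ∧ pt t x ∈ Y
    · obtain ⟨t, x, ht, hx, hlt, hmem⟩ := hp
      obtain ⟨M, hM⟩ := exists_one_lt_mul_two_pow (sub_pos.2 hlt)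
      exact ⟨M, fun a' ha' _ _ _ _ _ _ => ⟨t, x, ht, hx, hmem, hM a' ha'⟩⟩
    · exact ⟨0, fun _ _ t x ht hx hlt hmem => absurd ⟨t, x, ht, hx, hlt, hmem⟩ hp⟩
  choose M hM using hex
  refine ⟨max (a + 1) (Finset.univ.sup M), (Nat.lt_succ_self a).trans_le (le_max_left _ _),
    fun s j t x ht hx hlt hmem => ?_⟩
  have hj1 := hlt.trans_le ht
  rw [div_lt_one (by positivity)] at hj1
  have hj2 : j < 2 ^ a := by exact_mod_cast hj1
  have hle : a ≤ max (a + 1) (Finset.univ.sup M) := (Nat.le_succ a).trans (le_max_left _ _)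
  -- The given point is replaced by the fixed witness for `(s, j)`, whose excess height exceeds the
  -- new mesh.
  obtain ⟨t, x, ht, hx, hmem, hlt⟩ := hM (s, ⟨j, hj2⟩) (max (a + 1) (Finset.univ.sup M))
    ((Finset.le_sup (f := M) (Finset.mem_univ _)).trans (le_max_right _ _)) t x ht hx hlt hmem
  generalize max (a + 1) (Finset.univ.sup M) = a' at *
  obtain ⟨c, rfl⟩ := Nat.exists_eq_add_of_le hle
  refine hY.reach_of_mem ht hx hmem ?_
  rw [Nat.add_sub_cancel_left, div_le_iff₀ (by positivity)]
  have hcalc : (t - (j : ℝ) / 2 ^ a) * 2 ^ (a + c) = t * 2 ^ (a + c) - j * 2 ^ c := by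
    rw [pow_add]; field_simp
  simp only at hlt
  rw [hcalc] at hlt
  push_cast
  linarith

theorem IsTopFan.exists_isAdmissible {Y : Set CantorFan} (hY : IsTopFan Y) :
    ∃ α : ℕ → ℕ, StrictMono α ∧ ∃ n₀ : ℕ,
      IsAdmissible Y (fun n => α (n₀ + n)) fun n => n₀ + n := by
  obtain ⟨hstar, y, t, hy, h⟩ := hY.isStarlike
  obtain ⟨n₀, hn₀⟩ := hstar.exists_legs hy h
  choose next hnext hgap using hstar.exists_gap
  -- The argument `n + 1` is the cylinder length of the next level, as `gap` demands.
  let α : ℕ → ℕ := fun n => Nat.rec 0 (fun n a => next a (n + 1)) n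
  have hα : StrictMono α := strictMono_nat_of_lt_succ fun n => hnext (α n) (n + 1)
  have hadd : StrictMono fun n => n₀ + n := fun _ _ h => Nat.add_lt_add_left h n₀
  refine ⟨α, hα, n₀, hstar, hα.comp hadd, hadd, fun n => hn₀ _ ?_ _ (Nat.le_add_right n₀ n),
    fun n => hgap (α (n₀ + n)) (n₀ + n + 1)⟩
  exact (Nat.le_add_right n₀ n).trans hα.le_apply

end FanSpec

/-! ### Assembly: the first two statements follow from the last two -/

theorem mainTheorem6 :
    (∃ S : FanSpec.GraphSeq, S.InX ∧ Nonempty (S.Spec ≃ₜ FanSpec.CantorFan)) ∧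
    (∀ (Z : Type*) [TopologicalSpace Z], FanSpec.IsSmoothFan Z →
      ∃ S : FanSpec.GraphSeq, S.InL ∧ Nonempty (S.Spec ≃ₜ Z)) ∧
    (∀ α β : ℕ → ℕ, StrictMono α → StrictMono β →
      ∃ n₀ : ℕ, ∃ S : FanSpec.GraphSeq, S.InX ∧
        S.IsRealizedBy (fun n => FanSpec.fanCover (α (n₀ + n)) (β (n₀ + n))) ∧
        Nonempty (S.Spec ≃ₜ FanSpec.CantorFan)) ∧
    (∀ Y : Set FanSpec.CantorFan, FanSpec.IsTopFan Y →
      ∃ α : ℕ → ℕ, StrictMono α ∧ ∃ n₀ : ℕ, ∃ S : FanSpec.GraphSeq, S.InL ∧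
        S.IsRealizedBy (fun n => FanSpec.restrictedCover (α (n₀ + n)) (n₀ + n) Y) ∧
        Nonempty (S.Spec ≃ₜ Y)) := by
  have h3 : ∀ α β : ℕ → ℕ, StrictMono α → StrictMono β →
      ∃ n₀ : ℕ, ∃ S : FanSpec.GraphSeq, S.InX ∧
        S.IsRealizedBy (fun n => FanSpec.fanCover (α (n₀ + n)) (β (n₀ + n))) ∧
        Nonempty (S.Spec ≃ₜ FanSpec.CantorFan) := by
    intro α β hα hβ
    obtain ⟨n₀, h⟩ := FanSpec.isAdmissible_univ hα hβ
    obtain ⟨e⟩ := FanSpec.coverSeq_spectrum h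
    refine ⟨n₀, FanSpec.coverSeq h, FanSpec.coverSeq_inX h, ?_,
      ⟨e.trans (Homeomorph.Set.univ _)⟩⟩
    have := FanSpec.coverSeq_isRealizedBy h
    simpa only [FanSpec.restrictedCover_univ] using this
  have h4 : ∀ Y : Set FanSpec.CantorFan, FanSpec.IsTopFan Y →
      ∃ α : ℕ → ℕ, StrictMono α ∧ ∃ n₀ : ℕ, ∃ S : FanSpec.GraphSeq, S.InL ∧
        S.IsRealizedBy (fun n => FanSpec.restrictedCover (α (n₀ + n)) (n₀ + n) Y) ∧
        Nonempty (S.Spec ≃ₜ Y) := by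
    intro Y hY
    obtain ⟨α, hα, n₀, h⟩ := hY.exists_isAdmissible
    exact ⟨α, hα, n₀, FanSpec.coverSeq h, FanSpec.coverSeq_inL h,
      FanSpec.coverSeq_isRealizedBy h, FanSpec.coverSeq_spectrum h⟩
  refine ⟨?_, ?_, h3, h4⟩
  · obtain ⟨-, S, hS, -, hS'⟩ := h3 id id strictMono_id strictMono_id
    exact ⟨S, hS, hS'⟩
  · rintro Z _ ⟨Y, hY, ⟨e⟩⟩
    obtain ⟨-, -, -, S, hS, -, ⟨e'⟩⟩ := h4 Y hY
    exact ⟨S, hS, ⟨e'.trans e.symm⟩⟩
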